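/- Let $\mathbb{B}$ be the Bargmann space of entire functions $\varphi$ on $\mathbb{C}$ with $\int_{\mathbb{C}}|\varphi(z)|^2e^{-|z|^2}\,dx\,dy<\infty$, with inner product $\langle\varphi,\psi\rangle=\frac1\pi\int_{\mathbb{C}}\varphi(z)\overline{\psi(z)}e^{-|z|^2}\,dx\,dy$, and let $e_k(z)=z^k/\sqrt{k!}$. Let $A\varphi=\varphi'$ and $(A^*\varphi)(z)=z\varphi(z)$. For integers $p,m\ge 1$ put $$H^{p,m}=A^{*p}(A^m+A^{*m})A^p ,\qquad \mathbb{B}_p=\{\varphi\in\mathbb{B}:\varphi(0)=\varphi'(0)=\dots=\varphi^{(p-1)}(0)=0\}.$$ Let $\mathbb{H}$ be the minimal operator generated by $H^{p,m}$ in $\mathbb{B}_p$, that is, the closure in $\mathbb{B}_p$ of $H^{p,m}$ restricted to the polynomials in $\mathbb{B}_p$. For a densely defined closed symmetric operator $T$ in a complex Hilbert space $\mathcal{H}$, the deficiency numbers are $n_\pm(T)=\dim\big(\mathcal{H}\ominus\operatorname{ran}(T-zI)\big)$ for $\pm\operatorname{Im}z>0$ (independently of the choice of $z$ in the half-plane).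 An operator generated by a block Jacobi matrix with $m\times m$ blocks is called completely indeterminate if $n_+=n_-=m$. Suppose $p+\frac m2>1$. Then: 1. In the orthonormal basis $(e_k)_{k\ge p}$ of $\mathbb{B}_p$, grouped into consecutive blocks of length $m$, $\mathbb{H}$ is given by a block Jacobi matrix. Precisely, let $\ell^2_m$ be the space of square summable sequences $(\phi_i)_{i\ge1}$ in $\mathbb{C}^m$, let $B_i$ ($i\ge 1$) be the diagonal $m\times m$ matrix with the entries $$\beta_k=\frac{\sqrt{k!\,(k+m)!}}{(k-p)!},\qquad p+(i-1)m\le k\le p+im-1 ,$$ and let $\mathbb{J}$ be the closure in $\ell^2_m$ of the operator $(\mathfrak{J}\phi)_i=B_{i-1}\phi_{i-1}+B_i\phi_{i+1}$ ($\phi_0=0$) on finite sequences. The map sending the $j$-th unit vector ($1\le j\le m$) in the $i$-th block to $e_{p+(i-1)m+j-1}$ extends to a unitary operator $U:\ell^2_m\to\mathbb{B}_p$, and $\mathbb{H}=U\,\mathbb{J}\,U^{-1}$. 2. $\mathbb{H}$ is densely defined, closed and symmetric, and it is completely indeterminate: $n_+(\mathbb{H})=n_-(\mathbb{H})=m$.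 3. The same holds in the whole Bargmann space: the closure in $\mathbb{B}$ of $H^{p,m}$ restricted to all polynomials is densely defined, closed and symmetric, with deficiency numbers $n_+=n_-=m$. -/

import Mathlib

open MeasureTheory
open scoped ComplexConjugate InnerProductSpace

noncomputable section

namespace Heun

/-! ### The Bargmann space -/

/-- The Gaussian probability measure `π⁻¹ exp(-|z|²) dx dy` on the complex plane. -/
def gaussian : Measure ℂ :=
  volume.withDensity fun z : ℂ => ENNReal.ofReal (Real.pi⁻¹ * Real.exp (-‖z‖ ^ 2))

/-- The entire functions that are square integrable against the Gaussian measure, as a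
vector space of functions. -/
def bargmannSubmodule : Submodule ℂ (ℂ → ℂ) where
  carrier := {φ | Differentiable ℂ φ ∧ MemLp φ 2 gaussian}
  add_mem' hf hg := ⟨hf.1.add hg.1, hf.2.add hg.2⟩
  zero_mem' := ⟨differentiable_const 0, MemLp.zero⟩
  smul_mem' c _ hf := ⟨hf.1.const_smul c, hf.2.const_smul c⟩

/-- The Bargmann space; its norm and inner product are introduced below. (It is a separate type
so that it does not inherit the topology of pointwise convergence.) -/
def Bargmann : Type := bargmannSubmodule

namespace Bargmann

instance : AddCommGroup Bargmann := inferInstanceAs (AddCommGroup bargmannSubmodule)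
instance : Module ℂ Bargmann := inferInstanceAs (Module ℂ bargmannSubmodule)

/-- The entire function that an element of the Bargmann space is. -/
def toFun (f : Bargmann) : ℂ → ℂ := Subtype.val (p := fun φ => φ ∈ bargmannSubmodule) f

instance : CoeFun Bargmann (fun _ => ℂ → ℂ) := ⟨toFun⟩

/-- An element of the Bargmann space from a function. -/
def mk (φ : ℂ → ℂ) (h₁ : Differentiable ℂ φ) (h₂ : MemLp φ 2 gaussian) : Bargmann := ⟨φ, h₁, h₂⟩

@[simp] theorem mk_apply (φ : ℂ → ℂ) (h₁ h₂) (z : ℂ) : mk φ h₁ h₂ z = φ z := rfl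
@[simp] theorem coe_mk (φ : ℂ → ℂ) (h₁ h₂) : (mk φ h₁ h₂ : ℂ → ℂ) = φ := rfl
@[simp] theorem coe_add (f g : Bargmann) : ((f + g : Bargmann) : ℂ → ℂ) = (f : ℂ → ℂ) + g := rfl
@[simp] theorem coe_smul (c : ℂ) (f : Bargmann) :
    ((c • f : Bargmann) : ℂ → ℂ) = c • (f : ℂ → ℂ) := rfl
@[simp] theorem coe_zero : ((0 : Bargmann) : ℂ → ℂ) = 0 := rfl

@[ext] theorem ext {f g : Bargmann} (h : ∀ z, f z = g z) : f = g := Subtype.ext (funext h)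

theorem differentiable (f : Bargmann) : Differentiable ℂ f :=
  (Subtype.property (p := fun φ => φ ∈ bargmannSubmodule) f).1
theorem memLp (f : Bargmann) : MemLp f 2 gaussian :=
  (Subtype.property (p := fun φ => φ ∈ bargmannSubmodule) f).2

theorem volume_ac_gaussian : (volume : Measure ℂ) ≪ gaussian := by
  refine withDensity_absolutelyContinuous' (by fun_prop) ?_
  filter_upwards with z
  have : 0 < Real.pi⁻¹ * Real.exp (-‖z‖ ^ 2) := by positivity
  simpa using this

/-- The inner product `⟪f, g⟫ = π⁻¹ ∫ conj (f z) g z exp(-|z|²) dx dy`, antilinear in the first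
variable. -/
instance : Inner ℂ Bargmann := ⟨fun f g => ∫ z, conj (f z) * g z ∂gaussian⟩

theorem inner_def (f g : Bargmann) : inner ℂ f g = ∫ z, conj (f z) * g z ∂gaussian := rfl

theorem inner_eq_inner_toLp (f g : Bargmann) :
    inner ℂ f g = inner ℂ (f.memLp.toLp f) (g.memLp.toLp g) := by
  rw [inner_def, L2.inner_def]
  refine integral_congr_ae ?_
  filter_upwards [f.memLp.coeFn_toLp, g.memLp.coeFn_toLp] with z h₁ h₂
  rw [h₁, h₂, RCLike.inner_apply, mul_comm]

theorem eq_zero_of_inner_self (f : Bargmann) (hf : inner ℂ f f = 0) : f = 0 := by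
  rw [inner_eq_inner_toLp, inner_self_eq_zero] at hf
  have h₀ : (f : ℂ → ℂ) =ᵐ[gaussian] (0 : ℂ → ℂ) := by
    have h₁ := f.memLp.coeFn_toLp
    rw [hf] at h₁
    exact h₁.symm.trans (Lp.coeFn_zero ℂ 2 gaussian)
  have h : (f : ℂ → ℂ) =ᵐ[volume] (fun _ => (0 : ℂ)) := volume_ac_gaussian.ae_eq h₀
  have h' : (f : ℂ → ℂ) = fun _ => (0 : ℂ) :=
    (Continuous.ae_eq_iff_eq volume f.differentiable.continuous continuous_const).1 h
  exact ext fun z => congrFun h' z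

/-- The inner product is a positive definite Hermitian form. -/
@[reducible]
def innerCore : InnerProductSpace.Core ℂ Bargmann where
  inner f g := inner ℂ f g
  conj_inner_symm f g := by
    rw [inner_eq_inner_toLp, inner_eq_inner_toLp, inner_conj_symm]
  re_inner_nonneg f := by
    rw [inner_eq_inner_toLp]; exact inner_self_nonneg
  add_left f g h := by
    simp only [inner_eq_inner_toLp]
    rw [← inner_add_left]; rfl
  smul_left f g c := by
    simp only [inner_eq_inner_toLp]
    rw [← inner_smul_left]; rfl
  definite f hf := eq_zero_of_inner_self f hf

instance : NormedAddCommGroup Bargmann := innerCore.toNormedAddCommGroup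
instance : InnerProductSpace ℂ Bargmann := InnerProductSpace.ofCore innerCore.toCore

end Bargmann

/-- The subspace of the Bargmann space of the functions that vanish at `0` together with their
derivatives of order less than `p`. -/
def bargmannVanishing (p : ℕ) : Submodule ℂ Bargmann where
  carrier := {f | ∀ j < p, iteratedDeriv j f 0 = 0}
  add_mem' {f g} hf hg j hj := by
    rw [Bargmann.coe_add, iteratedDeriv_add f.differentiable.contDiff.contDiffAt
      g.differentiable.contDiff.contDiffAt, hf j hj, hg j hj, add_zero]
  zero_mem' j _ := by
    rw [Bargmann.coe_zero]
    simp [iteratedDeriv_eq_iteratedFDeriv]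
  smul_mem' c f hf j hj := by
    rw [Bargmann.coe_smul, iteratedDeriv_const_smul f.differentiable.contDiff.contDiffAt c,
      hf j hj, smul_zero]

/-! ### The generalized Heun operator -/

/-- The annihilation expression `A φ = φ'`. -/
def annihilation (φ : ℂ → ℂ) : ℂ → ℂ := deriv φ

/-- The creation expression `(A* φ)(z) = z φ(z)`. -/
def creation (φ : ℂ → ℂ) : ℂ → ℂ := fun z => z * φ z

/-- The differential expression `H^{p,m} = A*^p (A^m + A*^m) A^p`. -/
def heunExpr (p m : ℕ) (φ : ℂ → ℂ) : ℂ → ℂ :=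
  creation^[p] (annihilation^[m] (annihilation^[p] φ) + creation^[m] (annihilation^[p] φ))

/-- The action of `H^{p,m}` on polynomials. -/
def heunPoly (p m : ℕ) (q : Polynomial ℂ) : Polynomial ℂ :=
  Polynomial.X ^ p * (Polynomial.derivative^[m] (Polynomial.derivative^[p] q) +
    Polynomial.X ^ m * Polynomial.derivative^[p] q)

theorem iterate_annihilation_eval (k : ℕ) (q : Polynomial ℂ) :
    annihilation^[k] (fun z => q.eval z) = fun z => (Polynomial.derivative^[k] q).eval z := by
  induction k generalizing q with
  | zero => rfl
  | succ k ih =>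
    rw [Function.iterate_succ_apply, Function.iterate_succ_apply, ← ih]
    congr 1
    funext z
    exact q.deriv

theorem iterate_creation (k : ℕ) (φ : ℂ → ℂ) : creation^[k] φ = fun z => z ^ k * φ z := by
  induction k generalizing φ with
  | zero => funext z; simp
  | succ k ih =>
    rw [Function.iterate_succ_apply, ih]
    funext z
    simp only [creation]
    ring

theorem heunExpr_eval (p m : ℕ) (q : Polynomial ℂ) :
    heunExpr p m (fun z => q.eval z) = fun z => (heunPoly p m q).eval z := by
  funext z
  simp [heunExpr, heunPoly, iterate_annihilation_eval, iterate_creation]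

theorem heunPoly_add (p m : ℕ) (q r : Polynomial ℂ) :
    heunPoly p m (q + r) = heunPoly p m q + heunPoly p m r := by
  simp only [heunPoly, iterate_map_add]
  ring

theorem heunPoly_smul (p m : ℕ) (c : ℂ) (q : Polynomial ℂ) :
    heunPoly p m (c • q) = c • heunPoly p m q := by
  simp only [heunPoly, Polynomial.smul_eq_C_mul, Polynomial.iterate_derivative_C_mul]
  ring

theorem memLp_pow (n : ℕ) : MemLp (fun z : ℂ => z ^ n) 2 gaussian := by
  rw [memLp_two_iff_integrable_sq_norm (by fun_prop), gaussian,
    integrable_withDensity_iff (by fun_prop) (by simp)]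
  have hint : Integrable (fun z : ℂ => Real.exp (-(1 / 2) * ‖z‖ ^ 2)) := by
    have := (GaussianFourier.integrable_cexp_neg_mul_sq_norm_add (V := ℂ) (b := 1 / 2)
      (by norm_num) 0 0).norm
    refine this.congr (Filter.Eventually.of_forall fun z => ?_)
    simp only [Complex.norm_exp]
    congr 1
    simp [← Complex.ofReal_pow]
  refine (hint.const_mul (n.factorial * 2 ^ n * Real.pi⁻¹)).mono' (by fun_prop) ?_
  filter_upwards with z
  rw [ENNReal.toReal_ofReal (by positivity), Real.norm_of_nonneg (by positivity), norm_pow,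
    ← pow_mul, mul_comm n 2, pow_mul]
  have h := Real.pow_div_factorial_le_exp (‖z‖ ^ 2 / 2) (by positivity) n
  rw [div_le_iff₀ (by positivity), div_pow, div_le_iff₀ (by positivity)] at h
  have he : Real.exp (-‖z‖ ^ 2) =
      Real.exp (-(1 / 2) * ‖z‖ ^ 2) * (Real.exp (‖z‖ ^ 2 / 2))⁻¹ := by
    rw [← Real.exp_neg, ← Real.exp_add]; congr 1; ring
  rw [he]
  have hpos := Real.exp_pos (‖z‖ ^ 2 / 2)
  calc (‖z‖ ^ 2) ^ n * (Real.pi⁻¹ *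
        (Real.exp (-(1 / 2) * ‖z‖ ^ 2) * (Real.exp (‖z‖ ^ 2 / 2))⁻¹))
      ≤ (Real.exp (‖z‖ ^ 2 / 2) * n.factorial * 2 ^ n) * (Real.pi⁻¹ *
        (Real.exp (-(1 / 2) * ‖z‖ ^ 2) * (Real.exp (‖z‖ ^ 2 / 2))⁻¹)) := by
        gcongr
    _ = n.factorial * 2 ^ n * Real.pi⁻¹ * Real.exp (-(1 / 2) * ‖z‖ ^ 2) := by
        field_simp

theorem memLp_eval (q : Polynomial ℂ) : MemLp (fun z => q.eval z) 2 gaussian := by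
  simp only [Polynomial.eval_eq_sum_range]
  exact memLp_finsetSum _ fun n _ => (memLp_pow n).const_mul _

/-- A polynomial as an element of the Bargmann space. -/
def ofPolynomial (q : Polynomial ℂ) : Bargmann :=
  Bargmann.mk (fun z => q.eval z) q.differentiable (memLp_eval q)

/-- The subspace of polynomials in the Bargmann space. -/
def polynomials : Submodule ℂ Bargmann where
  carrier := {f | ∃ q : Polynomial ℂ, f = ofPolynomial q}
  add_mem' := by
    rintro _ _ ⟨q, rfl⟩ ⟨r, rfl⟩
    exact ⟨q + r, by ext z; simp [ofPolynomial]⟩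
  zero_mem' := ⟨0, by ext z; simp [ofPolynomial]⟩
  smul_mem' := by
    rintro c _ ⟨q, rfl⟩
    exact ⟨c • q, by ext z; simp [ofPolynomial]⟩

theorem heunExpr_mem (p m : ℕ) {f : Bargmann} (hf : f ∈ polynomials) :
    ∃ q, heunExpr p m f = ofPolynomial q := by
  obtain ⟨q, rfl⟩ := hf
  exact ⟨heunPoly p m q, heunExpr_eval p m q⟩

/-- `H^{p,m}` as an operator in the Bargmann space with domain the polynomials. -/
def heunCore (p m : ℕ) : Bargmann →ₗ.[ℂ] Bargmann where
  domain := polynomials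
  toFun :=
    { toFun := fun f => Bargmann.mk (heunExpr p m (f : Bargmann))
        (by obtain ⟨q, hq⟩ := heunExpr_mem p m f.2; rw [hq]; exact Bargmann.differentiable _)
        (by obtain ⟨q, hq⟩ := heunExpr_mem p m f.2; rw [hq]; exact Bargmann.memLp _)
      map_add' := by
        rintro ⟨_, q, rfl⟩ ⟨_, r, rfl⟩
        have h : ((ofPolynomial q + ofPolynomial r : Bargmann) : ℂ → ℂ)
            = fun z => (q + r).eval z := by funext z; simp [ofPolynomial]
        ext z
        simp only [Submodule.coe_add, Bargmann.coe_add, Bargmann.coe_mk, Pi.add_apply]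
        rw [← Bargmann.coe_add, h]
        rw [heunExpr_eval, heunPoly_add]
        simp only [ofPolynomial, Bargmann.coe_mk, heunExpr_eval, Polynomial.eval_add]
      map_smul' := by
        rintro c ⟨_, q, rfl⟩
        have h : ((c • ofPolynomial q : Bargmann) : ℂ → ℂ)
            = fun z => (c • q).eval z := by funext z; simp [ofPolynomial]
        ext z
        simp only [Submodule.coe_smul, Bargmann.coe_smul, Bargmann.coe_mk, RingHom.id_apply,
          Pi.smul_apply]
        rw [← Bargmann.coe_smul, h]
        rw [heunExpr_eval, heunPoly_smul]
        simp only [ofPolynomial, Bargmann.coe_mk, heunExpr_eval, Polynomial.eval_smul] }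

theorem heunCore_mem (p m : ℕ) (f : (heunCore p m).domain) :
    heunCore p m f ∈ bargmannVanishing p := by
  obtain ⟨_, q, rfl⟩ := f
  intro j hj
  change iteratedDeriv j (heunExpr p m fun z => q.eval z) 0 = 0
  rw [heunExpr_eval, iteratedDeriv_eq_iterate]
  have := congrFun (iterate_annihilation_eval j (heunPoly p m q)) 0
  refine this.trans ?_
  rw [← Polynomial.coeff_zero_eq_eval_zero, Polynomial.coeff_iterate_derivative, heunPoly,
    Polynomial.coeff_X_pow_mul', if_neg (by omega), smul_zero]

/-- `H^{p,m}` as an operator in the subspace `bargmannVanishing p`, with domain the polynomials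
of that subspace. -/
def heunCoreVanishing (p m : ℕ) : bargmannVanishing p →ₗ.[ℂ] bargmannVanishing p where
  domain := polynomials.comap (bargmannVanishing p).subtype
  toFun :=
    { toFun := fun f => ⟨heunCore p m ⟨f.1.1, f.2⟩, heunCore_mem p m _⟩
      map_add' := fun f g => Subtype.ext
        ((heunCore p m).map_add ⟨f.1.1, f.2⟩ ⟨g.1.1, g.2⟩)
      map_smul' := fun c f => Subtype.ext
        ((heunCore p m).map_smul c ⟨f.1.1, f.2⟩) }

/-- The minimal operator generated by `H^{p,m}` in the whole Bargmann space: the closure of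
`H^{p,m}` on the polynomials. -/
def heunMinimal (p m : ℕ) : Bargmann →ₗ.[ℂ] Bargmann := (heunCore p m).closure

/-- The minimal operator generated by `H^{p,m}` in the subspace `bargmannVanishing p`: the closure
of `H^{p,m}` on the polynomials of that subspace. -/
def heunMinimalVanishing (p m : ℕ) : bargmannVanishing p →ₗ.[ℂ] bargmannVanishing p :=
  (heunCoreVanishing p m).closure

/-! ### Block Jacobi matrices -/

/-- The Hilbert space of square summable sequences of vectors of `ℂ^m`; blocks are numbered
from `0`. -/
abbrev BlockSeq (m : ℕ) : Type := lp (fun _ : ℕ => EuclideanSpace ℂ (Fin m)) 2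

/-- The formal action of the block Jacobi matrix with diagonal blocks `A i`, with blocks `B i` just
above and `(B i)*` just below the diagonal:
`(𝔍 φ) i = (B (i-1))* φ (i-1) + A i φ i + B i φ (i+1)`, where the first term is absent
for `i = 0`. -/
def jacobiAction {m : ℕ} (A B : ℕ → Matrix (Fin m) (Fin m) ℂ)
    (φ : ℕ → EuclideanSpace ℂ (Fin m)) : ℕ → EuclideanSpace ℂ (Fin m)
  | 0 => Matrix.toEuclideanLin (A 0) (φ 0) + Matrix.toEuclideanLin (B 0) (φ 1)
  | i + 1 => Matrix.toEuclideanLin (B i).conjTranspose (φ i) +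
      Matrix.toEuclideanLin (A (i + 1)) (φ (i + 1)) + Matrix.toEuclideanLin (B (i + 1)) (φ (i + 2))

/-- The finite sequences. -/
def finiteSeq (m : ℕ) : Submodule ℂ (BlockSeq m) where
  carrier := {φ | ∃ N, ∀ i, N ≤ i → φ i = 0}
  add_mem' := by
    rintro φ ψ ⟨M, hM⟩ ⟨N, hN⟩
    refine ⟨max M N, fun i hi => ?_⟩
    rw [lp.coeFn_add, Pi.add_apply, hM i (le_trans (le_max_left _ _) hi),
      hN i (le_trans (le_max_right _ _) hi), add_zero]
  zero_mem' := ⟨0, fun i _ => rfl⟩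
  smul_mem' := by
    rintro c φ ⟨M, hM⟩
    refine ⟨M, fun i hi => ?_⟩
    rw [lp.coeFn_smul, Pi.smul_apply, hM i hi, smul_zero]

theorem memℓp_jacobiAction {m : ℕ} (A B : ℕ → Matrix (Fin m) (Fin m) ℂ) {φ : BlockSeq m}
    (hφ : φ ∈ finiteSeq m) : Memℓp (jacobiAction A B φ) 2 := by
  obtain ⟨N, hN⟩ := hφ
  refine (memℓp_zero ((Set.finite_le_nat N).subset fun i hi => ?_)).of_exponent_ge zero_le
  by_contra h
  apply hi
  have h' : N < i := not_le.1 h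
  cases i with
  | zero => omega
  | succ i => simp [jacobiAction, hN i (by omega), hN (i + 1) (by omega), hN (i + 2) (by omega)]

/-- The block Jacobi matrix as an operator on the finite sequences. -/
def jacobiCore {m : ℕ} (A B : ℕ → Matrix (Fin m) (Fin m) ℂ) : BlockSeq m →ₗ.[ℂ] BlockSeq m where
  domain := finiteSeq m
  toFun :=
    { toFun := fun φ => ⟨jacobiAction A B φ.1, memℓp_jacobiAction A B φ.2⟩
      map_add' := by
        intro φ ψ
        refine lp.ext (funext fun i => ?_)
        change jacobiAction A B (φ.1 + ψ.1 : BlockSeq m) i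
          = jacobiAction A B φ.1 i + jacobiAction A B ψ.1 i
        cases i <;> simp only [jacobiAction, lp.coeFn_add, Pi.add_apply, map_add] <;> abel
      map_smul' := by
        intro c φ
        refine lp.ext (funext fun i => ?_)
        change jacobiAction A B (c • φ.1 : BlockSeq m) i = c • jacobiAction A B φ.1 i
        cases i <;> simp only [jacobiAction, lp.coeFn_smul, Pi.smul_apply, map_smul, smul_add] }

/-- The minimal operator generated by a block Jacobi matrix: the closure of its action on finite
sequences. -/
def jacobiMinimal {m : ℕ} (A B : ℕ → Matrix (Fin m) (Fin m) ℂ) : BlockSeq m →ₗ.[ℂ] BlockSeq m :=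
  (jacobiCore A B).closure

/-- The numbers `β_k = √(k! (k+m)!) / (k-p)!`, meant for `k ≥ p`. -/
def beta (p m k : ℕ) : ℝ := √((k.factorial : ℝ) * ((k + m).factorial : ℝ)) / ((k - p).factorial : ℝ)

/-- The off-diagonal block with number `i` of `H^{p,m}`: the diagonal matrix with entries `β_k`,
`p + i m ≤ k < p + (i + 1) m`. -/
def heunBlock (p m i : ℕ) : Matrix (Fin m) (Fin m) ℂ :=
  Matrix.diagonal fun j => (beta p m (p + i * m + j) : ℂ)

/-- `e_k(z) = z^k / √(k!)`. -/
def e (k : ℕ) : ℂ → ℂ := fun z => z ^ k / (√(k.factorial : ℝ) : ℂ)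

/-! ### Deficiency numbers -/

section Deficiency

variable {E : Type*} [NormedAddCommGroup E] [InnerProductSpace ℂ E]

/-- The deficiency subspace `E ⊖ ran (T - z)`. -/
def deficiencySubspace (T : E →ₗ.[ℂ] E) (z : ℂ) : Submodule ℂ E :=
  (LinearMap.range (T.toFun - z • T.domain.subtype))ᗮ

/-- `T` has the deficiency numbers `(nUpper, nLower)`: the deficiency subspace at `z` has dimension `nUpper`
for every `z` in the open upper half-plane and `nLower` for every `z` in the open lower half-plane. -/
def HasDeficiencyNumbers (T : E →ₗ.[ℂ] E) (nUpper nLower : ℕ) : Prop :=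
  (∀ z : ℂ, 0 < z.im → Module.rank ℂ (deficiencySubspace T z) = nUpper) ∧
    ∀ z : ℂ, z.im < 0 → Module.rank ℂ (deficiencySubspace T z) = nLower

/-- `T` is a densely defined closed symmetric operator. -/
structure IsClosedSymmetric (T : E →ₗ.[ℂ] E) : Prop where
  dense_domain : Dense (T.domain : Set E)
  isClosed : T.IsClosed
  symmetric : T.IsFormalAdjoint T

/-- `T` is a densely defined closed symmetric operator with deficiency numbers `n₊ = n₋ = m`,
where `m ≠ 0`. -/
def IsCompletelyIndeterminate (T : E →ₗ.[ℂ] E) (m : ℕ) : Prop :=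
  IsClosedSymmetric T ∧ m ≠ 0 ∧ HasDeficiencyNumbers T m m

end Deficiency

end Heun

end

noncomputable section

namespace Heun

/-! ### Parseval's identity in the Bargmann space -/

/-! In an orthonormal basis each of the three operators is a symmetric weighted shift of step `m`:
`b k` goes to `γ k • b (k + m) + γ (k - m) • b (k - m)`, on the span of the basis. For the monomials
in the Bargmann space this comes from differentiating `z ^ k` and normalising (`heunPoly_monomial`);
that the monomials are a Hilbert basis is Parseval's identity in polar coordinates
(`lintegral_gaussian_sq`). Two shifts with the same weights have unitarily equivalent closures,
because the unitary that matches the bases matches the generators of the graphs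
(`mem_graph_closure_iff`). This gives the block Jacobi form, whose diagonal blocks make one block up
the same as `m` indices up.

A vector lies in the deficiency subspace at `z` exactly when its coordinates solve the shift
recurrence with parameter `conj z` (`mem_deficiencySubspace_closure_iff`). The recurrence splits
along residue classes mod `m` into `m` scalar three-term recurrences, each with a one-parameter
family of solutions. So the dimension is `m` as soon as all solutions are square summable.
Berezanskii's criterion (`summable_norm_sq_of_recurrence`) gives this for log-concave weights with
summable inverses. The `β_k` are such weights: their squares are products of increasing linear
factors, and they grow at least like a power with exponent `p + m/2 > 1`.

In the whole Bargmann space the first `p` monomials are annihilated; since `z ≠ 0`, they add nothing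
to the deficiency subspaces. -/

theorem hasSum_norm_sq_of_orthonormal {ι E : Type*} [NormedAddCommGroup E]
    [InnerProductSpace ℂ E] {v : ι → E} (hv : Orthonormal ℂ v) {a : ι → ℂ} {g : E}
    (h : HasSum (fun k => a k • v k) g) : HasSum (fun k => ‖a k‖ ^ 2) (‖g‖ ^ 2) := by
  classical
  have h₁ (k : ι) : ⟪v k, g⟫_ℂ = a k := by
    have h₂ := h.mapL (innerSL ℂ (v k))
    refine h₂.unique ?_
    convert! hasSum_ite_eq k (a k) using 2 with l
    rw [innerSL_apply_apply, inner_smul_right, orthonormal_iff_ite.1 hv]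
    by_cases hkl : l = k
    · simp [hkl]
    · simp [hkl, Ne.symm hkl]
  have h₃ := Complex.hasSum_re (h.mapL (innerSL ℂ g))
  simp only [innerSL_apply_apply] at h₃
  convert h₃ using 1
  · funext k
    rw [inner_smul_right, ← inner_conj_symm, h₁, Complex.mul_conj, Complex.normSq_eq_norm_sq,
      Complex.ofReal_re]
  · exact norm_sq_eq_re_inner (𝕜 := ℂ) g

/-- Parseval on the circle: absolutely summable coefficients give a uniformly convergent Fourier
series, hence a continuous `G` whose expansion also holds in `L²`. The open interval is the angular
range of polar coordinates. -/
theorem lintegral_circle_sq {a : ℕ → ℂ} (ha : Summable fun k => ‖a k‖) :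
    ∫⁻ θ in Set.Ioo (-Real.pi) Real.pi,
        ‖∑' k, a k * Complex.exp (θ * Complex.I) ^ k‖ₑ ^ 2 =
      ENNReal.ofReal (2 * Real.pi) * ∑' k, ‖a k‖ₑ ^ 2 := by
  have hT : Fact (0 < 2 * Real.pi) := ⟨Real.two_pi_pos⟩
  have hs : Summable fun k : ℕ => a k • (fourier (k : ℤ) : C(AddCircle (2 * Real.pi), ℂ)) := by
    refine Summable.of_norm ?_
    simpa only [norm_smul, fourier_norm, mul_one] using ha
  obtain ⟨G, hG⟩ := hs
  have hGx (θ : ℝ) : G θ = ∑' k, a k * Complex.exp (θ * Complex.I) ^ k := by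
    have h := hG.mapL (ContinuousMap.evalCLM ℂ (θ : AddCircle (2 * Real.pi)))
    refine Eq.trans ?_ (h.tsum_eq.symm.trans ?_)
    · rfl
    congr 1
    funext k
    simp only [ContinuousMap.evalCLM_apply, ContinuousMap.smul_apply, smul_eq_mul,
      fourier_coe_apply]
    rw [← Complex.exp_nat_mul]
    congr 2
    have : (Real.pi : ℂ) ≠ 0 := by exact_mod_cast Real.pi_ne_zero
    push_cast
    field_simp
  simp_rw [← hGx]
  rw [setLIntegral_congr Ioo_ae_eq_Ioc,
    show Set.Ioc (-Real.pi) Real.pi = Set.Ioc (-Real.pi) (-Real.pi + 2 * Real.pi) by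
      congr 1; ring,
    AddCircle.lintegral_preimage (2 * Real.pi) (-Real.pi) (fun x => ‖G x‖ₑ ^ 2),
    AddCircle.volume_eq_smul_haarAddCircle, lintegral_smul_measure, smul_eq_mul]
  congr 1
  have hL : HasSum (fun k : ℕ => a k • fourierLp (T := 2 * Real.pi) 2 (k : ℤ))
      (ContinuousMap.toLp (E := ℂ) 2 AddCircle.haarAddCircle ℂ G) := by
    simpa using hG.mapL (ContinuousMap.toLp (E := ℂ) 2 AddCircle.haarAddCircle ℂ)
  have hP := hasSum_norm_sq_of_orthonormal
    (orthonormal_fourier.comp (fun k : ℕ => (k : ℤ)) Nat.cast_injective) hL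
  have hint : Integrable (fun x => ‖G x‖ ^ 2) AddCircle.haarAddCircle :=
    (by fun_prop : Continuous fun x => ‖G x‖ ^ 2).integrable_of_hasCompactSupport
      (HasCompactSupport.of_compactSpace _)
  have hN : ‖ContinuousMap.toLp (E := ℂ) 2 AddCircle.haarAddCircle ℂ G‖ ^ 2 =
      ∫ x, ‖G x‖ ^ 2 ∂AddCircle.haarAddCircle := by
    rw [norm_sq_eq_re_inner (𝕜 := ℂ), ContinuousMap.inner_toLp]
    have : ∀ x, G x * (starRingEnd ℂ) (G x) = ((‖G x‖ ^ 2 : ℝ) : ℂ) := fun x => by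
      rw [Complex.mul_conj, Complex.normSq_eq_norm_sq]
    simp_rw [this, integral_complex_ofReal]
    simp
  have he (z : ℂ) : ‖z‖ₑ ^ 2 = ENNReal.ofReal (‖z‖ ^ 2) := by
    rw [ENNReal.ofReal_pow (norm_nonneg _), ofReal_norm]
  simp_rw [he]
  rw [← ofReal_integral_eq_lintegral_ofReal hint (Filter.Eventually.of_forall fun x => by positivity),
    ← hN, ← hP.tsum_eq, ENNReal.ofReal_tsum_of_nonneg (fun k => by positivity) hP.summable]

/-- The integral is `2 ∫ r^(2k+1) exp(-r²) dr = Γ(k+1)`. -/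
theorem lintegral_radial_moment (k : ℕ) :
    ∫⁻ r in Set.Ioi (0 : ℝ), ENNReal.ofReal r *
        (ENNReal.ofReal (Real.pi⁻¹ * Real.exp (-r ^ 2)) *
          (ENNReal.ofReal (2 * Real.pi) * ENNReal.ofReal r ^ (2 * k))) = k.factorial := by
  have h := integral_rpow_mul_exp_neg_mul_rpow (p := 2) (q := 2 * k + 1) (b := 1) two_pos
    (by linarith [(Nat.cast_nonneg k : (0 : ℝ) ≤ k)]) one_pos
  have hi := integrableOn_rpow_mul_exp_neg_mul_rpow (p := 2) (s := 2 * k + 1) (b := 1)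
    (by linarith [(Nat.cast_nonneg k : (0 : ℝ) ≤ k)]) two_pos one_pos
  have hG : ((2 * k + 1 + 1 : ℝ)) / 2 = k + 1 := by ring
  rw [hG, Real.Gamma_nat_eq_factorial, Real.one_rpow] at h
  rw [show (k.factorial : ENNReal) = ENNReal.ofReal (2 * (1 * (1 / 2) * k.factorial)) by
    rw [show 2 * (1 * (1 / 2) * (k.factorial : ℝ)) = k.factorial by ring,
      ENNReal.ofReal_natCast], ← h, ← integral_const_mul,
    ofReal_integral_eq_lintegral_ofReal (hi.const_mul 2)]
  · refine setLIntegral_congr_fun measurableSet_Ioi fun r (hr : 0 < r) => ?_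
    rw [← ENNReal.ofReal_pow hr.le, ← ENNReal.ofReal_mul (by positivity),
      ← ENNReal.ofReal_mul (by positivity), ← ENNReal.ofReal_mul (by positivity)]
    congr 1
    have h₁ : r ^ (2 * k : ℝ) = r ^ (2 * k) := by exact_mod_cast Real.rpow_natCast r (2 * k)
    have := Real.pi_ne_zero
    rw [Real.rpow_add hr, Real.rpow_one, Real.rpow_two, h₁]
    rw [neg_one_mul]
    field_simp
  · filter_upwards [ae_restrict_mem measurableSet_Ioi] with r hr
    have : 0 < r := hr
    positivity

/-- Polar coordinates, Parseval on each circle, then the radial moments term by term. Both sides may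
be infinite, so the identity decides membership in the Bargmann space as well as the norm. -/
theorem lintegral_gaussian_sq {f : ℂ → ℂ} (hf : Continuous f) {c : ℕ → ℂ}
    (hc : ∀ z, HasSum (fun k => c k * z ^ k) (f z)) :
    ∫⁻ z, ‖f z‖ₑ ^ 2 ∂gaussian = ∑' k, ‖c k‖ₑ ^ 2 * k.factorial := by
  have hm : Measurable fun z : ℂ => ‖f z‖ₑ ^ 2 := by fun_prop
  rw [gaussian, lintegral_withDensity_eq_lintegral_mul _ (by fun_prop) hm,
    ← Complex.lintegral_comp_polarCoord_symm, polarCoord_target, Measure.volume_eq_prod,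
    ← Measure.prod_restrict, lintegral_prod]
  swap
  · refine Measurable.aemeasurable ?_
    have := hf.measurable
    simp only [Complex.polarCoord_symm_apply, Pi.mul_apply, smul_eq_mul]
    fun_prop
  calc
    _ = ∫⁻ r in Set.Ioi (0 : ℝ), ∑' k, ‖c k‖ₑ ^ 2 * (ENNReal.ofReal r *
        (ENNReal.ofReal (Real.pi⁻¹ * Real.exp (-r ^ 2)) *
          (ENNReal.ofReal (2 * Real.pi) * ENNReal.ofReal r ^ (2 * k)))) := by
      refine setLIntegral_congr_fun measurableSet_Ioi fun r (hr : 0 < r) => ?_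
      simp only [Pi.mul_apply, smul_eq_mul, Complex.polarCoord_symm_apply]
      have hn (θ : ℝ) : ‖(r : ℂ) * (Real.cos θ + Real.sin θ * Complex.I)‖ = r := by
        rw [norm_mul, Complex.norm_real, Real.norm_of_nonneg hr.le]
        push_cast
        rw [Complex.norm_cos_add_sin_mul_I, mul_one]
      have hv (θ : ℝ) : f ((r : ℂ) * (Real.cos θ + Real.sin θ * Complex.I)) =
          ∑' k, c k * (r : ℂ) ^ k * Complex.exp (θ * Complex.I) ^ k := by
        rw [← (hc _).tsum_eq]
        congr 1
        funext k
        rw [mul_pow, Complex.exp_mul_I]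
        push_cast
        ring
      simp_rw [hn, hv]
      rw [lintegral_const_mul' _ _ ENNReal.ofReal_ne_top,
        lintegral_const_mul' _ _ ENNReal.ofReal_ne_top, lintegral_circle_sq,
        ← ENNReal.tsum_mul_left, ← ENNReal.tsum_mul_left, ← ENNReal.tsum_mul_left]
      · congr 1
        funext k
        rw [enorm_mul, enorm_pow, mul_pow, ← pow_mul, mul_comm k 2,
          show ‖(r : ℂ)‖ₑ = ENNReal.ofReal r by
            rw [← ofReal_norm, Complex.norm_real, Real.norm_of_nonneg hr.le]]
        ring
      · exact (hc r).summable.norm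
    _ = _ := by
      rw [lintegral_tsum fun k => (by fun_prop)]
      congr 1
      funext k
      rw [lintegral_const_mul _ (by fun_prop), lintegral_radial_moment]

/-! ### The monomials form a Hilbert basis of the Bargmann space -/

/-- The difference of the coefficients represents `0`, and Parseval turns this into a vanishing sum
of nonnegative terms. -/
theorem powerSeries_coeff_unique {f : ℂ → ℂ} {c d : ℕ → ℂ}
    (hc : ∀ z, HasSum (fun k => c k * z ^ k) (f z))
    (hd : ∀ z, HasSum (fun k => d k * z ^ k) (f z)) : c = d := by
  have h := lintegral_gaussian_sq (f := 0) continuous_const (c := c - d) fun z => by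
    simpa [sub_mul] using (hc z).sub (hd z)
  simp only [Pi.zero_apply, enorm_zero, ne_eq, OfNat.ofNat_ne_zero, not_false_eq_true, zero_pow,
    lintegral_zero] at h
  funext k
  have hk := ENNReal.tsum_eq_zero.1 h.symm k
  simpa [Nat.factorial_ne_zero, sub_eq_zero] using hk

namespace Bargmann

/-- The coordinates of an entire function with respect to the monomials `e k`. -/
def coord (f : ℂ → ℂ) (k : ℕ) : ℂ := (√(k.factorial : ℝ) : ℂ)⁻¹ * iteratedDeriv k f 0

theorem sqrt_factorial_ne_zero (k : ℕ) : (√(k.factorial : ℝ) : ℂ) ≠ 0 := by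
  exact_mod_cast (Real.sqrt_pos.2 (by positivity)).ne'

theorem sqrt_factorial_mul_self (k : ℕ) :
    (√(k.factorial : ℝ) : ℂ) * (√(k.factorial : ℝ) : ℂ) = k.factorial := by
  exact_mod_cast Real.mul_self_sqrt (by positivity : (0 : ℝ) ≤ k.factorial)

theorem hasSum_coord {f : ℂ → ℂ} (hf : Differentiable ℂ f) (z : ℂ) :
    HasSum (fun k => coord f k / (√(k.factorial : ℝ) : ℂ) * z ^ k) (f z) := by
  convert! Complex.hasSum_taylorSeries_of_entire hf 0 z using 2 with k
  rw [coord, ← sqrt_factorial_mul_self, smul_eq_mul, smul_eq_mul, sub_zero]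
  have := sqrt_factorial_ne_zero k
  field_simp

theorem coord_eq_of_hasSum {f : ℂ → ℂ} (hf : Differentiable ℂ f) {a : ℕ → ℂ}
    (h : ∀ z, HasSum (fun k => a k / (√(k.factorial : ℝ) : ℂ) * z ^ k) (f z)) : coord f = a := by
  funext k
  have := congrFun (powerSeries_coeff_unique (hasSum_coord hf) h) k
  exact (div_left_inj' (sqrt_factorial_ne_zero k)).1 this

theorem enorm_sq_div_mul_factorial (a : ℂ) (k : ℕ) :
    ‖a / (√(k.factorial : ℝ) : ℂ)‖ₑ ^ 2 * k.factorial = ENNReal.ofReal (‖a‖ ^ 2) := by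
  rw [← ofReal_norm, ← ENNReal.ofReal_pow (norm_nonneg _), ← ENNReal.ofReal_natCast,
    ← ENNReal.ofReal_mul (by positivity)]
  congr 1
  rw [norm_div, div_pow, Complex.norm_real, Real.norm_of_nonneg (Real.sqrt_nonneg _),
    Real.sq_sqrt (by positivity)]
  field_simp

theorem lintegral_gaussian_coord {f : ℂ → ℂ} (hf : Differentiable ℂ f) :
    ∫⁻ z, ‖f z‖ₑ ^ 2 ∂gaussian = ∑' k, ENNReal.ofReal (‖coord f k‖ ^ 2) := by
  rw [lintegral_gaussian_sq hf.continuous (hasSum_coord hf)]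
  simp_rw [enorm_sq_div_mul_factorial]

theorem memLp_iff_summable_coord {f : ℂ → ℂ} (hf : Differentiable ℂ f) :
    MemLp f 2 gaussian ↔ Summable fun k => ‖coord f k‖ ^ 2 := by
  have h := eLpNorm_lt_top_iff_lintegral_rpow_enorm_lt_top (f := f) (μ := gaussian)
    (p := 2) (by simp) (by simp)
  simp only [ENNReal.toReal_ofNat, ENNReal.rpow_ofNat] at h
  rw [MemLp, and_iff_right hf.continuous.aestronglyMeasurable, h, lintegral_gaussian_coord hf,
    lt_top_iff_ne_top]
  refine ⟨fun h => ?_, fun h => h.tsum_ofReal_ne_top⟩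
  refine (ENNReal.summable_toReal h).congr fun k => ENNReal.toReal_ofReal (by positivity)

theorem hasSum_norm_sq_coord (f : Bargmann) : HasSum (fun k => ‖coord f k‖ ^ 2) (‖f‖ ^ 2) := by
  have hs := (memLp_iff_summable_coord f.differentiable).1 f.memLp
  convert hs.hasSum using 1
  rw [norm_sq_eq_re_inner (𝕜 := ℂ), inner_def]
  have h (z : ℂ) : conj (f z) * f z = ((‖f z‖ ^ 2 : ℝ) : ℂ) := by
    rw [mul_comm, Complex.mul_conj, Complex.normSq_eq_norm_sq]
  simp_rw [h, integral_complex_ofReal]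
  have hi : Integrable (fun z => ‖f z‖ ^ 2) gaussian :=
    (memLp_two_iff_integrable_sq_norm f.memLp.1).1 f.memLp
  rw [RCLike.re_eq_complex_re, Complex.ofReal_re,
    integral_eq_lintegral_of_nonneg_ae (Filter.Eventually.of_forall fun z => by positivity)
      hi.aestronglyMeasurable]
  have he (z : ℂ) : ENNReal.ofReal (‖f z‖ ^ 2) = ‖f z‖ₑ ^ 2 := by
    rw [ENNReal.ofReal_pow (norm_nonneg _), ofReal_norm]
  simp_rw [he, lintegral_gaussian_coord f.differentiable]
  rw [← ENNReal.ofReal_tsum_of_nonneg (fun k => by positivity) hs,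
    ENNReal.toReal_ofReal (tsum_nonneg fun k => by positivity)]

/-- The map of the Bargmann space to `ℓ²` given by the coordinates with respect to `e k`. -/
def coordIsometry : Bargmann →ₗᵢ[ℂ] lp (fun _ : ℕ => ℂ) 2 where
  toFun f := ⟨coord f, memℓp_gen (by simpa using (hasSum_norm_sq_coord f).summable)⟩
  map_add' f g := by
    refine lp.ext (funext fun k => ?_)
    change coord (f + g : Bargmann) k = coord f k + coord g k
    rw [coord, coord, coord, coe_add, iteratedDeriv_add f.differentiable.contDiff.contDiffAt
      g.differentiable.contDiff.contDiffAt, mul_add]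
  map_smul' c f := by
    refine lp.ext (funext fun k => ?_)
    change coord (c • f : Bargmann) k = c • coord f k
    rw [coord, coord, coe_smul, iteratedDeriv_const_smul f.differentiable.contDiff.contDiffAt c,
      smul_eq_mul, smul_eq_mul, mul_left_comm]
  norm_map' f := by
    have h := lp.hasSum_norm (p := 2) (by simp) (⟨coord f, memℓp_gen
      (by simpa using (hasSum_norm_sq_coord f).summable)⟩ : lp (fun _ : ℕ => ℂ) 2)
    simp only [ENNReal.toReal_ofNat, Real.rpow_ofNat] at h
    exact (pow_left_inj₀ (norm_nonneg _) (norm_nonneg _) two_ne_zero).1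
      (h.unique (hasSum_norm_sq_coord f))

/-- A square summable sequence of coordinates defines a locally uniformly convergent, hence entire,
series, and uniqueness of coefficients returns the sequence. -/
theorem coordIsometry_surjective : Function.Surjective coordIsometry := by
  intro a
  have ha : Summable fun k => ‖a k‖ ^ 2 := by
    simpa using (lp.memℓp a).summable (by simp)
  -- The majorant comes from `x y ≤ x² + y²` with `x = ‖a k‖` and `y = |R|^k / √(k!)`; the `y²` sum
  -- to an exponential.
  have hb (R : ℝ) : Summable fun k => ‖a k / (√(k.factorial : ℝ) : ℂ)‖ * R ^ k := by
    refine Summable.of_norm_bounded (ha.add (Real.summable_pow_div_factorial (R ^ 2))) fun k => ?_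
    have hR : (R ^ 2) ^ k / (k.factorial : ℝ) = (|R| ^ k / √(k.factorial : ℝ)) ^ 2 := by
      rw [div_pow, Real.sq_sqrt (by positivity), ← sq_abs R]
      ring
    rw [hR, norm_mul, norm_norm, norm_div, norm_pow, Real.norm_eq_abs, Complex.norm_real,
      Real.norm_of_nonneg (Real.sqrt_nonneg _), div_mul_eq_mul_div, mul_div_assoc]
    nlinarith [sq_nonneg (‖a k‖ - |R| ^ k / √(k.factorial : ℝ)), sq_nonneg ‖a k‖,
      sq_nonneg (|R| ^ k / √(k.factorial : ℝ))]
  have hle {R : ℝ} {z : ℂ} (hz : ‖z‖ ≤ R) (k : ℕ) : ‖a k / (√(k.factorial : ℝ) : ℂ) * z ^ k‖ ≤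
      ‖a k / (√(k.factorial : ℝ) : ℂ)‖ * R ^ k := by
    rw [norm_mul, norm_pow]
    gcongr
  have hs (z : ℂ) := (Summable.of_norm_bounded (hb ‖z‖) (hle le_rfl)).hasSum
  have hd : Differentiable ℂ fun z => ∑' k, a k / (√(k.factorial : ℝ) : ℂ) * z ^ k := by
    intro z
    refine (Complex.differentiableOn_tsum_of_summable_norm (U := Metric.ball 0 (‖z‖ + 1))
      (hb (‖z‖ + 1)) (fun k => by fun_prop) Metric.isOpen_ball fun k w hw => ?_).differentiableAt
        (Metric.isOpen_ball.mem_nhds (by simp))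
    exact hle (mem_ball_zero_iff.1 hw).le k
  have hc := coord_eq_of_hasSum hd hs
  refine ⟨mk _ hd ((memLp_iff_summable_coord hd).2 (by rwa [hc])), lp.ext hc⟩

/-- The Hilbert basis `e k` of the Bargmann space. -/
def basis : HilbertBasis ℕ ℂ Bargmann :=
  .ofRepr (LinearIsometryEquiv.ofSurjective coordIsometry coordIsometry_surjective)

theorem basis_repr (f : Bargmann) (k : ℕ) : basis.repr f k = coord f k := rfl

theorem e_eq_eval (k : ℕ) :
    e k = fun z => (Polynomial.monomial k (√(k.factorial : ℝ) : ℂ)⁻¹).eval z := by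
  funext z
  rw [e, Polynomial.eval_monomial, div_eq_inv_mul]

theorem basis_eq (k : ℕ) :
    basis k = ofPolynomial (Polynomial.monomial k (√(k.factorial : ℝ) : ℂ)⁻¹) := by
  apply basis.repr.injective
  rw [basis.repr_self]
  refine lp.ext (Eq.symm ?_)
  refine coord_eq_of_hasSum (differentiable _) fun z => ?_
  have h := hasSum_single (f := fun l => (lp.single (E := fun _ : ℕ => ℂ) 2 k 1 : ℕ → ℂ) l /
    (√(l.factorial : ℝ) : ℂ) * z ^ l) k fun l hl => by simp [hl]
  convert! h using 1
  simp [ofPolynomial, div_eq_inv_mul]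

theorem coe_basis (k : ℕ) : (basis k : ℂ → ℂ) = e k := by
  rw [basis_eq, e_eq_eval]
  rfl

instance : CompleteSpace Bargmann :=
  basis.repr.toIsometryEquiv.completeSpace

theorem inner_basis (k : ℕ) (f : Bargmann) : ⟪basis k, f⟫_ℂ = coord f k := by
  rw [← basis.repr_apply_apply, basis_repr]

end Bargmann

/-! ### Square summability of the solutions of a three-term recurrence -/

/-- A discrete Grönwall bound, from `1 + ε ≤ exp ε`. -/
theorem exists_bound_of_le_one_add_mul {M ε : ℕ → ℝ} (h0 : ∀ n, 0 ≤ M n) (hε : ∀ n, 0 ≤ ε n)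
    (hs : Summable ε) (h : ∀ n, M (n + 1) ≤ (1 + ε n) * M n) : ∃ C, ∀ n, M n ≤ C := by
  refine ⟨M 0 * Real.exp (∑' n, ε n), fun n => ?_⟩
  have hn : M n ≤ M 0 * Real.exp (∑ i ∈ Finset.range n, ε i) := by
    induction n with
    | zero => simp
    | succ n ih =>
      rw [Finset.sum_range_succ, Real.exp_add]
      have h₁ := Real.add_one_le_exp (ε n)
      calc M (n + 1) ≤ (1 + ε n) * M n := h n
        _ ≤ Real.exp (ε n) * (M 0 * Real.exp (∑ i ∈ Finset.range n, ε i)) := by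
          refine mul_le_mul (by linarith) ih (h0 n) (Real.exp_pos _).le
        _ = _ := by ring
  refine hn.trans ?_
  have := hs.sum_le_tsum (Finset.range n) fun i _ => hε i
  have := h0 0
  gcongr

/-- Log-concavity makes the successive ratios nonincreasing, so the first one bounds them all. -/
theorem div_antitone_of_log_concave {b : ℕ → ℝ} (hb : ∀ n, 0 < b n)
    (hlc : ∀ n, b n * b (n + 2) ≤ b (n + 1) ^ 2) (n : ℕ) : b (n + 1) ≤ b 1 / b 0 * b n := by
  induction n with
  | zero => rw [div_mul_cancel₀ _ (hb 0).ne']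
  | succ n ih =>
    have h₁ := hlc n
    have h₂ := hb n
    have h₃ := hb (n + 1)
    refine le_of_mul_le_mul_left (h₁.trans ?_) h₂
    calc b (n + 1) ^ 2 = b (n + 1) * b (n + 1) := sq _
      _ ≤ b 1 / b 0 * b n * b (n + 1) := by gcongr
      _ = _ := by ring

/-- Berezanskii's criterion: for log-concave weights with summable inverses all solutions of the
three-term recurrence are square summable. -/
theorem summable_norm_sq_of_recurrence {b : ℕ → ℝ} (hb : ∀ n, 0 < b n)
    (hlc : ∀ n, b n * b (n + 2) ≤ b (n + 1) ^ 2) (hs : Summable fun n => (b n)⁻¹) {z : ℂ}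
    {u : ℕ → ℂ} (hu : ∀ n, (b (n + 1) : ℂ) * u (n + 2) = z * u (n + 1) - b n * u n) :
    Summable fun n => ‖u n‖ ^ 2 := by
  -- The scale `√(b n)` is the expected size of `1 / ‖u n‖`: once `w` is bounded, `‖u n‖²` is at
  -- most a constant times `(b n)⁻¹`.
  set w : ℕ → ℝ := fun n => √(b n) * ‖u n‖ with hw
  set R := b 1 / b 0 with hR
  have hR0 : 0 ≤ R := (div_pos (hb 1) (hb 0)).le
  set ε : ℕ → ℝ := fun n => ‖z‖ * √R * (b (n + 1))⁻¹ with hε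
  have hw0 (n : ℕ) : 0 ≤ w n := by positivity
  have hε0 (n : ℕ) : 0 ≤ ε n := by
    have := hb (n + 1)
    positivity
  have hεs : Summable ε := ((summable_nat_add_iff 1).2 hs).mul_left _
  -- Log-concavity enters twice: `√(b (n+2) * b n) ≤ b (n+1)` gives `w n` the coefficient exactly
  -- `1`, and the ratio bound `R` makes the other coefficient summable.
  have hstep (n : ℕ) : w (n + 2) ≤ ε n * w (n + 1) + w n := by
    have h₀ := hb n
    have h₁ := hb (n + 1)
    have h₂ := hb (n + 2)
    have hn : b (n + 1) * ‖u (n + 2)‖ ≤ ‖z‖ * ‖u (n + 1)‖ + b n * ‖u n‖ := by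
      have := norm_sub_le (z * u (n + 1)) (b n * u n)
      rw [← hu, norm_mul, norm_mul, norm_mul, Complex.norm_real, Complex.norm_real,
        Real.norm_of_nonneg h₀.le, Real.norm_of_nonneg h₁.le] at this
      exact this
    have hr : √(b (n + 2)) ≤ √R * √(b (n + 1)) := by
      rw [← Real.sqrt_mul hR0]
      exact Real.sqrt_le_sqrt (div_antitone_of_log_concave hb hlc (n + 1))
    have hl : √(b (n + 2)) * √(b n) ≤ b (n + 1) := by
      rw [← Real.sqrt_mul h₂.le, Real.sqrt_le_left h₁.le, mul_comm]
      exact hlc n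
    refine le_of_mul_le_mul_left ?_ h₁
    calc b (n + 1) * w (n + 2) = √(b (n + 2)) * (b (n + 1) * ‖u (n + 2)‖) := by simp only [hw]; ring
      _ ≤ √(b (n + 2)) * (‖z‖ * ‖u (n + 1)‖ + b n * ‖u n‖) := by gcongr
      _ = ‖z‖ * √(b (n + 2)) * ‖u (n + 1)‖ + √(b (n + 2)) * √(b n) * (√(b n) * ‖u n‖) := by
        nth_rewrite 1 [← Real.mul_self_sqrt h₀.le]
        ring
      _ ≤ ‖z‖ * (√R * √(b (n + 1))) * ‖u (n + 1)‖ + b (n + 1) * (√(b n) * ‖u n‖) := by gcongr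
      _ = b (n + 1) * (ε n * w (n + 1) + w n) := by
        simp only [hw, hε]
        field_simp
  -- The maximum of two neighbours turns the second-order inequality into a first-order one.
  obtain ⟨C, hC⟩ := exists_bound_of_le_one_add_mul (M := fun n => max (w n) (w (n + 1)))
    (fun n => le_max_of_le_left (hw0 n)) hε0 hεs fun n => by
      have h₁ := le_max_left (w n) (w (n + 1))
      have h₂ := le_max_right (w n) (w (n + 1))
      have h₃ := mul_le_mul_of_nonneg_left h₂ (hε0 n)
      have h₄ := mul_nonneg (hε0 n) ((hw0 n).trans h₁)
      refine max_le ?_ ?_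
      · linarith
      · linarith [hstep n]
  refine Summable.of_nonneg_of_le (fun n => by positivity) (fun n => ?_) (hs.mul_left (C ^ 2))
  have h₀ := hb n
  have h₁ : w n ^ 2 ≤ C ^ 2 := pow_le_pow_left₀ (hw0 n) ((le_max_left _ _).trans (hC n)) 2
  rw [← div_eq_mul_inv, le_div_iff₀ h₀]
  calc ‖u n‖ ^ 2 * b n = w n ^ 2 := by simp only [hw]; rw [mul_pow, Real.sq_sqrt h₀.le]; ring
    _ ≤ _ := h₁

/-- The solution of the recurrence of a scalar Jacobi matrix with a given initial value. -/
def jacobiSolution (b : ℕ → ℝ) (z c : ℂ) : ℕ → ℂ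
  | 0 => c
  | 1 => z * c / b 0
  | n + 2 => (z * jacobiSolution b z c (n + 1) - b n * jacobiSolution b z c n) / b (n + 1)

theorem mul_jacobiSolution_one {b : ℕ → ℝ} (hb : ∀ n, 0 < b n) (z c : ℂ) :
    (b 0 : ℂ) * jacobiSolution b z c 1 = z * jacobiSolution b z c 0 := by
  have : (b 0 : ℂ) ≠ 0 := by exact_mod_cast (hb 0).ne'
  rw [jacobiSolution, jacobiSolution, mul_div_cancel₀ _ this]

theorem mul_jacobiSolution_add_two {b : ℕ → ℝ} (hb : ∀ n, 0 < b n) (z c : ℂ) (n : ℕ) :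
    (b (n + 1) : ℂ) * jacobiSolution b z c (n + 2) =
      z * jacobiSolution b z c (n + 1) - b n * jacobiSolution b z c n := by
  have : (b (n + 1) : ℂ) ≠ 0 := by exact_mod_cast (hb (n + 1)).ne'
  rw [jacobiSolution, mul_div_cancel₀ _ this]

theorem summable_of_forall_residue {f : ℕ → ℝ} (hf : ∀ k, 0 ≤ f k) {m : ℕ} (hm : m ≠ 0)
    (h : ∀ j < m, Summable fun n => f (n * m + j)) : Summable f := by
  have : NeZero m := ⟨hm⟩
  rw [← (Nat.divModEquiv m).symm.summable_iff, ← (Equiv.prodComm (Fin m) ℕ).summable_iff]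
  refine (summable_prod_of_nonneg fun _ => hf _).2 ?_
  refine ⟨fun j => ?_, Summable.of_finite⟩
  exact h j j.2

/-! ### Symmetric weighted shift operators of step `m` -/

section Shift

variable {E : Type} [NormedAddCommGroup E] [InnerProductSpace ℂ E]

/-- The image of the basis vector `b k` under the symmetric weighted shift of step `m`. -/
def shiftVector (b : HilbertBasis ℕ ℂ E) (γ : ℕ → ℝ) (m k : ℕ) : E :=
  (γ k : ℂ) • b (k + m) + if m ≤ k then (γ (k - m) : ℂ) • b (k - m) else 0

/-- `T` is the symmetric weighted shift of step `m` and with weights `γ`, on the span of `b`. -/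
structure IsSymmetricShift (b : HilbertBasis ℕ ℂ E) (γ : ℕ → ℝ) (m : ℕ) (T : E →ₗ.[ℂ] E) :
    Prop where
  domain_eq : T.domain = Submodule.span ℂ (Set.range b)
  apply_basis : ∀ k (h : b k ∈ T.domain), T ⟨b k, h⟩ = shiftVector b γ m k

/-- The recurrence that the coordinates of the vectors of a deficiency subspace satisfy. -/
def IsShiftSolution (γ : ℕ → ℝ) (m : ℕ) (z : ℂ) (x : ℕ → ℂ) : Prop :=
  ∀ k, (γ k : ℂ) * x (k + m) + (if m ≤ k then (γ (k - m) : ℂ) * x (k - m) else 0) = z * x k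

/-- Below `q` both weights vanish and the equation reads `z * x k = 0`, which is where `z ≠ 0`
matters. From `q + m` on, the equation at `k - m` determines `x k` from earlier entries. -/
theorem IsShiftSolution.eq_zero {γ : ℕ → ℝ} {m q : ℕ} (hm : m ≠ 0) (h0 : ∀ k < q, γ k = 0)
    (hpos : ∀ k, q ≤ k → 0 < γ k) {z : ℂ} (hz : z ≠ 0) {x : ℕ → ℂ}
    (hx : IsShiftSolution γ m z x) (hi : ∀ j < m, x (q + j) = 0) (k : ℕ) : x k = 0 := by
  induction k using Nat.strong_induction_on with
  | _ k ih =>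
    by_cases hk : k < q
    · have h := hx k
      rw [h0 k hk, h0 (k - m) (by omega)] at h
      simpa [hz, eq_comm] using h
    · by_cases hk' : k < q + m
      · obtain ⟨j, rfl⟩ := Nat.exists_eq_add_of_le (not_lt.1 hk)
        exact hi j (by omega)
      · have h := hx (k - m)
        have hγ : (γ (k - m) : ℂ) ≠ 0 := by exact_mod_cast (hpos (k - m) (by omega)).ne'
        rw [ih (k - m) (by omega), ih (k - m - m) (by omega), Nat.sub_add_cancel (by omega)] at h
        simpa [hγ] using h

/-- The indices `q + (n * m + j)` with fixed `j` form a chain that the recurrence does not leave, so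
a solution is assembled from `m` independent scalar ones, extended by zero below `q`. -/
theorem exists_isShiftSolution {γ : ℕ → ℝ} {m q : ℕ} (hm : m ≠ 0) (h0 : ∀ k < q, γ k = 0)
    (hpos : ∀ k, q ≤ k → 0 < γ k)
    (hlc : ∀ k, q ≤ k → γ k * γ (k + 2 * m) ≤ γ (k + m) ^ 2) (hs : Summable fun k => (γ k)⁻¹)
    (z : ℂ) (c : Fin m → ℂ) :
    ∃ x : ℕ → ℂ, IsShiftSolution γ m z x ∧ (∀ j : Fin m, x (q + j) = c j) ∧
      Summable fun k => ‖x k‖ ^ 2 := by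
  have hm0 : 0 < m := Nat.pos_of_ne_zero hm
  have : NeZero m := ⟨hm⟩
  set b : Fin m → ℕ → ℝ := fun j n => γ (q + (n * m + j)) with hb
  have hbpos (j n) : 0 < b j n := hpos _ (by omega)
  set u : Fin m → ℕ → ℂ := fun j => jacobiSolution (b j) z (c j) with hu
  set x : ℕ → ℂ := fun k => if k < q then 0 else u (Fin.ofNat m (k - q)) ((k - q) / m) with hx
  have hxu (j : Fin m) (n : ℕ) : x (q + (n * m + j)) = u j n := by
    have h₁ : (n * m + j) / m = n := by
      rw [mul_comm, Nat.mul_add_div hm0, Nat.div_eq_of_lt j.2, add_zero]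
    have h₂ : Fin.ofNat m (n * m + j) = j := by
      ext
      simp [Fin.ofNat, Nat.mod_eq_of_lt j.2]
    simp only [hx]
    rw [if_neg (by omega), Nat.add_sub_cancel_left, h₁, h₂]
  have hx0 {k : ℕ} (hk : k < q) : x k = 0 := if_pos hk
  refine ⟨x, fun k => ?_, fun j => ?_, ?_⟩
  · by_cases hk : k < q
    · rw [h0 k hk, h0 (k - m) (by omega), hx0 hk]
      simp
    · obtain ⟨j, n, rfl⟩ : ∃ (j : Fin m) (n : ℕ), k = q + (n * m + j) :=
        ⟨⟨(k - q) % m, Nat.mod_lt _ hm0⟩, (k - q) / m, by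
          have := Nat.div_add_mod' (k - q) m
          simp only
          omega⟩
      have hadd : q + (n * m + j) + m = q + ((n + 1) * m + j) := by ring
      rw [hadd, hxu, hxu]
      cases n with
      | zero =>
        -- At the start of a chain `m ≤ k` may hold, but then `k - m` lies below `q`, where the
        -- weight is zero.
        have : (if m ≤ q + (0 * m + j) then (γ (q + (0 * m + j) - m) : ℂ) *
            x (q + (0 * m + j) - m) else 0) = 0 := by
          split_ifs with h
          · rw [h0 _ (by have := j.2; omega)]
            simp
          · rfl
        rw [this, add_zero]
        exact mul_jacobiSolution_one (hbpos j) z (c j)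
      | succ n =>
        have hsub : q + ((n + 1) * m + j) - m = q + (n * m + j) := by
          rw [add_one_mul]
          omega
        rw [if_pos (by nlinarith [Nat.zero_le (n * m)]), hsub, hxu]
        have := mul_jacobiSolution_add_two (hbpos j) z (c j) n
        simp only [hu]
        linear_combination this
  · simpa [hu, jacobiSolution] using hxu j 0
  · refine (summable_nat_add_iff q).1 ?_
    refine summable_of_forall_residue (fun k => by positivity) hm fun j hj => ?_
    have h := summable_norm_sq_of_recurrence (z := z) (u := u ⟨j, hj⟩) (hbpos ⟨j, hj⟩)
      (fun n => ?_) ?_ (mul_jacobiSolution_add_two (hbpos ⟨j, hj⟩) z (c ⟨j, hj⟩))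
    · refine h.congr fun n => ?_
      rw [add_comm _ q, ← hxu ⟨j, hj⟩ n]
    · convert hlc (q + (n * m + j)) (by omega) using 2
      · simp only [hb]; congr 1; ring
      · simp only [hb]; congr 1; ring
    · refine hs.comp_injective (i := fun n => q + (n * m + j)) fun n n' h => ?_
      have h' : n * m = n' * m := by simpa using h
      exact Nat.eq_of_mul_eq_mul_right hm0 h'

namespace IsSymmetricShift

variable {b : HilbertBasis ℕ ℂ E} {γ : ℕ → ℝ} {m : ℕ} {T : E →ₗ.[ℂ] E}

/-- Closures are taken on graphs; with explicit generators, any closed linear condition on the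
closure need only be checked on basis vectors. -/
theorem graph_eq (hT : IsSymmetricShift b γ m T) :
    T.graph = Submodule.span ℂ (Set.range fun k => (b k, shiftVector b γ m k)) := by
  have hle : Submodule.span ℂ (Set.range fun k => (b k, shiftVector b γ m k)) ≤ T.graph := by
    rw [Submodule.span_le]
    rintro _ ⟨k, rfl⟩
    have hk : b k ∈ T.domain := hT.domain_eq ▸ Submodule.subset_span ⟨k, rfl⟩
    exact T.mem_graph_iff.2 ⟨⟨b k, hk⟩, rfl, hT.apply_basis k hk⟩
  refine le_antisymm (fun u hu => ?_) hle
  obtain ⟨y, hy, hyu⟩ : u.1 ∈ Submodule.map (LinearMap.fst ℂ E E)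
      (Submodule.span ℂ (Set.range fun k => (b k, shiftVector b γ m k))) := by
    rw [Submodule.map_span, ← Set.range_comp]
    obtain ⟨x, hx, -⟩ := T.mem_graph_iff.1 hu
    rw [← hx]
    exact hT.domain_eq ▸ x.2
  have h₁ : y.1 = u.1 := hyu
  have h₂ : y = u := Prod.ext h₁ (T.mem_graph_snd_inj (hle hy) hu h₁)
  exact h₂ ▸ hy

theorem dense_domain (hT : IsSymmetricShift b γ m T) : Dense (T.domain : Set E) := by
  rw [hT.domain_eq, Submodule.dense_iff_topologicalClosure_eq_top]
  exact b.dense_span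

theorem inner_basis_shiftVector (b : HilbertBasis ℕ ℂ E) (γ : ℕ → ℝ) (m k l : ℕ) :
    ⟪b l, shiftVector b γ m k⟫_ℂ =
      (if l = k + m then (γ k : ℂ) else 0) + if k = l + m then (γ l : ℂ) else 0 := by
  have ho := orthonormal_iff_ite.1 b.orthonormal
  rw [shiftVector, inner_add_right, inner_smul_right, ho]
  congr 1
  · simp
  · by_cases hk : m ≤ k
    · rw [if_pos hk, inner_smul_right, ho]
      by_cases h : l = k - m
      · rw [if_pos h, if_pos (by omega), h, mul_one]
      · rw [if_neg h, if_neg (by omega), mul_zero]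
    · rw [if_neg hk, inner_zero_right, if_neg (by omega)]

theorem inner_shiftVector_left (b : HilbertBasis ℕ ℂ E) (γ : ℕ → ℝ) (m k : ℕ) (ψ : E) :
    ⟪shiftVector b γ m k, ψ⟫_ℂ = (γ k : ℂ) * b.repr ψ (k + m) +
      if m ≤ k then (γ (k - m) : ℂ) * b.repr ψ (k - m) else 0 := by
  rw [shiftVector, inner_add_left, inner_smul_left, b.repr_apply_apply, Complex.conj_ofReal]
  congr 1
  split_ifs
  · rw [inner_smul_left, b.repr_apply_apply, Complex.conj_ofReal]
  · exact inner_zero_left _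

theorem inner_snd_fst (hT : IsSymmetricShift b γ m T) {u v : E × E} (hu : u ∈ T.graph)
    (hv : v ∈ T.graph) : ⟪u.2, v.1⟫_ℂ = ⟪u.1, v.2⟫_ℂ := by
  rw [hT.graph_eq] at hu hv
  induction hu, hv using Submodule.span_induction₂ with
  | mem_mem u v hu hv =>
    obtain ⟨k, rfl⟩ := hu
    obtain ⟨l, rfl⟩ := hv
    rw [← inner_conj_symm, inner_basis_shiftVector, inner_basis_shiftVector, map_add]
    simp only [apply_ite (starRingEnd ℂ), Complex.conj_ofReal, map_zero]
    exact add_comm _ _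
  | zero_left v _ => simp
  | zero_right u _ => simp
  | add_left u v w _ _ _ h₁ h₂ => simp [h₁, h₂]
  | add_right u v w _ _ _ h₁ h₂ => simp [h₁, h₂]
  | smul_left r u v _ _ h => simp [h]
  | smul_right r u v _ _ h => simp [h]

/-- Symmetry places `T` below its adjoint, which is closed. -/
theorem isClosable [CompleteSpace E] (hT : IsSymmetricShift b γ m T) : T.IsClosable := by
  have h : T.IsFormalAdjoint T := fun x y =>
    hT.inner_snd_fst (T.mem_graph x) (T.mem_graph y)
  exact (LinearPMap.adjoint_isClosed hT.dense_domain).isClosable.leIsClosable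
    (h.le_adjoint hT.dense_domain)

theorem isClosedSymmetric_closure [CompleteSpace E] (hT : IsSymmetricShift b γ m T) :
    IsClosedSymmetric T.closure where
  dense_domain := hT.dense_domain.mono T.le_closure.1
  isClosed := hT.isClosable.closure_isClosed
  symmetric x y := by
    -- Symmetry passes to the closure one variable at a time.
    have h₁ {v : E × E} (hv : v ∈ T.graph) {u : E × E} (hu : u ∈ T.closure.graph) :
        ⟪u.2, v.1⟫_ℂ = ⟪u.1, v.2⟫_ℂ := by
      rw [← hT.isClosable.graph_closure_eq_closure_graph] at hu
      exact closure_minimal (t := {u : E × E | ⟪u.2, v.1⟫_ℂ = ⟪u.1, v.2⟫_ℂ})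
        (fun u hu => hT.inner_snd_fst hu hv) (isClosed_eq (by fun_prop) (by fun_prop)) hu
    have h₂ {u : E × E} (hu : u ∈ T.closure.graph) {v : E × E} (hv : v ∈ T.closure.graph) :
        ⟪u.2, v.1⟫_ℂ = ⟪u.1, v.2⟫_ℂ := by
      rw [← hT.isClosable.graph_closure_eq_closure_graph] at hv
      exact closure_minimal (t := {v : E × E | ⟪u.2, v.1⟫_ℂ = ⟪u.1, v.2⟫_ℂ})
        (fun v hv => h₁ hv hu) (isClosed_eq (by fun_prop) (by fun_prop)) hv
    exact h₂ (T.closure.mem_graph x) (T.closure.mem_graph y)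

/-- Orthogonality of `ψ` to `y - z • x` is a closed linear condition `K` on pairs `(x, y)`, so it is
tested on the generators of the graph. The conjugate appears because the inner product is antilinear
in its first variable. -/
theorem mem_deficiencySubspace_closure_iff [CompleteSpace E] (hT : IsSymmetricShift b γ m T)
    (z : ℂ) (ψ : E) : ψ ∈ deficiencySubspace T.closure z ↔
      IsShiftSolution γ m (conj z) (b.repr ψ) := by
  set K : Submodule ℂ (E × E) := ((Submodule.span ℂ {ψ})ᗮ).comap
    (LinearMap.snd ℂ E E - z • LinearMap.fst ℂ E E) with hK
  have hKc : IsClosed (K : Set (E × E)) :=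
    (Submodule.isClosed_orthogonal _).preimage
      (by fun_prop : Continuous fun u : E × E => u.2 - z • u.1)
  have hKm (u : E × E) : u ∈ K ↔ ⟪u.2 - z • u.1, ψ⟫_ℂ = 0 := by
    rw [hK, Submodule.mem_comap, Submodule.mem_orthogonal_singleton_iff_inner_left]
    rfl
  have h₁ : ψ ∈ deficiencySubspace T.closure z ↔ T.closure.graph ≤ K := by
    rw [deficiencySubspace, Submodule.mem_orthogonal]
    refine ⟨fun h u hu => ?_, ?_⟩
    · obtain ⟨x, hx₁, hx₂⟩ := T.closure.mem_graph_iff.1 hu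
      rw [hKm, ← hx₁, ← hx₂]
      exact h _ ⟨x, rfl⟩
    · rintro h _ ⟨x, rfl⟩
      exact (hKm _).1 (h (T.closure.mem_graph x))
  rw [h₁, ← hT.isClosable.graph_closure_eq_closure_graph]
  have h₂ : T.graph.topologicalClosure ≤ K ↔ T.graph ≤ K :=
    ⟨T.graph.le_topologicalClosure.trans, fun h => T.graph.topologicalClosure_minimal h hKc⟩
  rw [h₂, hT.graph_eq, Submodule.span_le, Set.range_subset_iff]
  refine forall_congr' fun k => ?_
  rw [SetLike.mem_coe, hKm, inner_sub_left, inner_shiftVector_left, inner_smul_left,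
    ← b.repr_apply_apply, sub_eq_zero]

/-- Reading off the coordinates `q, …, q + m - 1` is an isomorphism onto `Fin m → ℂ`: injective
since they determine a solution, surjective since every solution with such initial data is square
summable. -/
theorem rank_deficiencySubspace_closure [CompleteSpace E] (hT : IsSymmetricShift b γ m T)
    {q : ℕ} (hm : m ≠ 0) (h0 : ∀ k < q, γ k = 0) (hpos : ∀ k, q ≤ k → 0 < γ k)
    (hlc : ∀ k, q ≤ k → γ k * γ (k + 2 * m) ≤ γ (k + m) ^ 2)
    (hs : Summable fun k => (γ k)⁻¹) {z : ℂ} (hz : z ≠ 0) :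
    Module.rank ℂ (deficiencySubspace T.closure z) = m := by
  have hz' : conj z ≠ 0 := by simpa using hz
  let L : deficiencySubspace T.closure z →ₗ[ℂ] Fin m → ℂ :=
    { toFun := fun ψ j => b.repr ψ (q + j)
      map_add' := fun ψ χ => by ext j; simp
      map_smul' := fun c ψ => by ext j; simp }
  have hinj : Function.Injective L := by
    rw [← LinearMap.ker_eq_bot, LinearMap.ker_eq_bot']
    intro ψ hψ
    have h := ((hT.mem_deficiencySubspace_closure_iff z ψ).1 ψ.2).eq_zero hm h0 hpos hz'
      fun j hj => congrFun hψ ⟨j, hj⟩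
    refine Subtype.ext (b.repr.injective ?_)
    rw [ZeroMemClass.coe_zero, map_zero]
    exact lp.ext (funext h)
  have hsurj : Function.Surjective L := by
    intro c
    obtain ⟨x, hx, hxc, hxs⟩ := exists_isShiftSolution hm h0 hpos hlc hs (conj z) c
    let a : lp (fun _ : ℕ => ℂ) 2 := ⟨x, memℓp_gen (by simpa using hxs)⟩
    have ha : b.repr (b.repr.symm a) = a := b.repr.apply_symm_apply a
    refine ⟨⟨b.repr.symm a, (hT.mem_deficiencySubspace_closure_iff z _).2 (by rwa [ha])⟩,
      funext fun j => ?_⟩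
    change b.repr (b.repr.symm a) (q + j) = c j
    rw [ha]
    exact hxc j
  rw [(LinearEquiv.ofBijective L ⟨hinj, hsurj⟩).rank_eq, rank_fin_fun]

theorem isCompletelyIndeterminate_closure [CompleteSpace E] (hT : IsSymmetricShift b γ m T)
    {q : ℕ} (hm : m ≠ 0) (h0 : ∀ k < q, γ k = 0) (hpos : ∀ k, q ≤ k → 0 < γ k)
    (hlc : ∀ k, q ≤ k → γ k * γ (k + 2 * m) ≤ γ (k + m) ^ 2)
    (hs : Summable fun k => (γ k)⁻¹) : IsCompletelyIndeterminate T.closure m := by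
  refine ⟨hT.isClosedSymmetric_closure, hm, fun z hz => ?_, fun z hz => ?_⟩ <;>
  · refine hT.rank_deficiencySubspace_closure hm h0 hpos hlc hs ?_
    rintro rfl
    simp at hz

theorem mem_graph_closure_iff [CompleteSpace E] {F : Type} [NormedAddCommGroup F]
    [InnerProductSpace ℂ F] [CompleteSpace F] {b' : HilbertBasis ℕ ℂ F} {S : F →ₗ.[ℂ] F}
    (hT : IsSymmetricShift b γ m T) (hS : IsSymmetricShift b' γ m S) (φ ψ : E) :
    (φ, ψ) ∈ T.closure.graph ↔ ((b.repr.trans b'.repr.symm) φ, (b.repr.trans b'.repr.symm) ψ) ∈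
      S.closure.graph := by
  set U := b.repr.trans b'.repr.symm with hU
  let L : (E × E) ≃L[ℂ] (F × F) :=
    U.toContinuousLinearEquiv.prodCongr U.toContinuousLinearEquiv
  have hUb (k : ℕ) : U (b k) = b' k := by
    rw [hU, LinearIsometryEquiv.trans_apply, b.repr_self, b'.repr_symm_single]
  have hUs (k : ℕ) : U (shiftVector b γ m k) = shiftVector b' γ m k := by
    rw [shiftVector, shiftVector, map_add, map_smul, hUb]
    split_ifs
    · rw [map_smul, hUb]
    · rw [map_zero]
  have hg : L '' (T.graph : Set (E × E)) = S.graph := by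
    have h : T.graph.map (L : (E × E) →ₗ[ℂ] (F × F)) = S.graph := by
      rw [hT.graph_eq, hS.graph_eq, Submodule.map_span, ← Set.range_comp]
      congr 2
      funext k
      exact Prod.ext (hUb k) (hUs k)
    rw [← h]
    rfl
  rw [← hT.isClosable.graph_closure_eq_closure_graph,
    ← hS.isClosable.graph_closure_eq_closure_graph, ← SetLike.mem_coe, ← SetLike.mem_coe,
    Submodule.topologicalClosure_coe, Submodule.topologicalClosure_coe, ← hg,
    ← L.image_closure, show (U φ, U ψ) = L (φ, ψ) from rfl, L.injective.mem_set_image]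

end IsSymmetricShift

end Shift

theorem _root_.HilbertBasis.mem_span_of_repr_eq_zero {E : Type*} [NormedAddCommGroup E]
    [InnerProductSpace ℂ E] (b : HilbertBasis ℕ ℂ E) {x : E} {N : ℕ}
    (h : ∀ k, N ≤ k → b.repr x k = 0) : x ∈ Submodule.span ℂ (Set.range b) := by
  have hs := (b.hasSum_repr x).unique (hasSum_sum_of_ne_finset_zero (s := Finset.range N)
    fun k hk => by rw [h k (by simpa using hk), zero_smul])
  rw [hs]
  exact Submodule.sum_mem _ fun k _ => Submodule.smul_mem _ _ (Submodule.subset_span ⟨k, rfl⟩)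

/-! ### The weights `β_k` -/

/-- Cancelling `n!` leaves the root of a product of `2p + m` linear factors in `n`, from which
log-concavity and growth are read off. -/
theorem beta_add (p m n : ℕ) : beta p m (p + n) =
    √(((n + 1).ascFactorial p : ℝ) * ((n + 1).ascFactorial (p + m) : ℝ)) := by
  have h₁ : ((p + n).factorial : ℝ) = n.factorial * (n + 1).ascFactorial p := by
    exact_mod_cast (add_comm p n ▸ (Nat.factorial_mul_ascFactorial n p).symm)
  have h₂ : ((p + n + m).factorial : ℝ) = n.factorial * (n + 1).ascFactorial (p + m) := by
    exact_mod_cast (show p + n + m = n + (p + m) by ring) ▸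
      (Nat.factorial_mul_ascFactorial n (p + m)).symm
  have h₃ : (0 : ℝ) < n.factorial := by positivity
  rw [beta, h₁, h₂, Nat.add_sub_cancel_left, div_eq_iff h₃.ne',
    show (n.factorial * (n + 1).ascFactorial p * (n.factorial * (n + 1).ascFactorial (p + m)) : ℝ) =
      (n + 1).ascFactorial p * (n + 1).ascFactorial (p + m) * n.factorial ^ 2 by ring,
    Real.sqrt_mul (by positivity), Real.sqrt_sq h₃.le]

theorem beta_pos (p m k : ℕ) : 0 < beta p m k := by
  unfold beta
  positivity

/-- It holds factor by factor: `(a - m)(a + m) ≤ a²` with `a = n + m + k`. -/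
theorem ascFactorial_log_concave (k m n : ℕ) :
    n.ascFactorial k * (n + 2 * m).ascFactorial k ≤ (n + m).ascFactorial k ^ 2 := by
  induction k with
  | zero => simp
  | succ k ih =>
    simp only [Nat.ascFactorial_succ]
    calc (n + k) * n.ascFactorial k * ((n + 2 * m + k) * (n + 2 * m).ascFactorial k)
        = (n + k) * (n + 2 * m + k) * (n.ascFactorial k * (n + 2 * m).ascFactorial k) := by ring
      _ ≤ (n + m + k) ^ 2 * (n + m).ascFactorial k ^ 2 :=
        Nat.mul_le_mul (by nlinarith [Nat.zero_le (m * m)]) ih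
      _ = _ := by ring

theorem beta_log_concave (p m n : ℕ) :
    beta p m (p + n) * beta p m (p + n + 2 * m) ≤ beta p m (p + n + m) ^ 2 := by
  rw [add_assoc p n, add_assoc p n, beta_add, beta_add, beta_add, Real.sq_sqrt (by positivity),
    ← Real.sqrt_mul (by positivity), Real.sqrt_le_left (by positivity)]
  have h₁ := ascFactorial_log_concave p m (n + 1)
  have h₂ := ascFactorial_log_concave (p + m) m (n + 1)
  rw [show n + 2 * m + 1 = n + 1 + 2 * m by ring, show n + m + 1 = n + 1 + m by ring]
  have h₃ := Nat.mul_le_mul h₁ h₂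
  have h₄ : ((n + 1).ascFactorial p * (n + 1 + 2 * m).ascFactorial p *
      ((n + 1).ascFactorial (p + m) * (n + 1 + 2 * m).ascFactorial (p + m)) : ℝ) ≤
      (n + 1 + m).ascFactorial p ^ 2 * (n + 1 + m).ascFactorial (p + m) ^ 2 := by
    exact_mod_cast h₃
  calc _ = _ := by ring
    _ ≤ _ := h₄
    _ = _ := by ring

/-- Each of the `2p + m` factors under the root is at least `n + 1`. -/
theorem rpow_le_beta (p m n : ℕ) : ((n + 1 : ℕ) : ℝ) ^ ((p : ℝ) + m / 2) ≤ beta p m (p + n) := by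
  rw [beta_add]
  refine Real.le_sqrt_of_sq_le ?_
  have h₀ : (0 : ℝ) ≤ ((n + 1 : ℕ) : ℝ) := by positivity
  rw [← Real.rpow_natCast, ← Real.rpow_mul h₀,
    show ((p : ℝ) + m / 2) * (2 : ℕ) = ((p + (p + m) : ℕ) : ℝ) by push_cast; ring,
    Real.rpow_natCast, pow_add]
  exact_mod_cast Nat.mul_le_mul (Nat.pow_succ_le_ascFactorial (n + 1) p)
    (Nat.pow_succ_le_ascFactorial (n + 1) (p + m))

theorem summable_inv_beta {p m : ℕ} (h : 1 < (p : ℝ) + m / 2) :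
    Summable fun n => (beta p m (p + n))⁻¹ := by
  refine Summable.of_nonneg_of_le (fun n => (inv_pos.2 (beta_pos p m _)).le) (fun n => ?_)
    ((summable_nat_add_iff 1).2 (Real.summable_nat_rpow_inv.2 h))
  exact inv_anti₀ (by positivity) (rpow_le_beta p m n)

/-! ### The Heun operator in the basis of monomials -/

/-- The weights of `H^{p,m}` in the basis `e k` of the whole Bargmann space. -/
def heunWeight (p m k : ℕ) : ℝ := if k < p then 0 else beta p m k

theorem heunWeight_add (p m n : ℕ) : heunWeight p m (p + n) = beta p m (p + n) :=
  if_neg (by omega)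

/-- The coefficient of the raising term `A*^(p+m) A^p`, rewritten for normalised monomials. The
lowering term below produces the same `beta`, which is the symmetry of the operator. -/
theorem sqrt_factorial_inv_mul_factorial_div (p m n : ℕ) :
    (√((p + n).factorial : ℝ) : ℂ)⁻¹ * ((p + n).factorial / n.factorial : ℂ) =
      beta p m (p + n) * (√((p + n + m).factorial : ℝ) : ℂ)⁻¹ := by
  have h₁ := Bargmann.sqrt_factorial_ne_zero (p + n)
  have h₂ := Bargmann.sqrt_factorial_ne_zero (p + n + m)
  have h₃ : (n.factorial : ℂ) ≠ 0 := by exact_mod_cast n.factorial_ne_zero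
  rw [beta, Real.sqrt_mul (by positivity), Nat.add_sub_cancel_left,
    ← Bargmann.sqrt_factorial_mul_self (p + n)]
  push_cast
  field_simp

theorem sqrt_factorial_inv_mul_factorial_div' (p m n : ℕ) :
    (√((p + n + m).factorial : ℝ) : ℂ)⁻¹ * ((p + n + m).factorial / n.factorial : ℂ) =
      beta p m (p + n) * (√((p + n).factorial : ℝ) : ℂ)⁻¹ := by
  have h₁ := Bargmann.sqrt_factorial_ne_zero (p + n)
  have h₂ := Bargmann.sqrt_factorial_ne_zero (p + n + m)
  have h₃ : (n.factorial : ℂ) ≠ 0 := by exact_mod_cast n.factorial_ne_zero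
  rw [beta, Real.sqrt_mul (by positivity), Nat.add_sub_cancel_left,
    ← Bargmann.sqrt_factorial_mul_self (p + n + m)]
  push_cast
  field_simp

theorem iterate_derivative_monomial (n l : ℕ) (c : ℂ) :
    Polynomial.derivative^[n] (Polynomial.monomial (n + l) c) =
      Polynomial.monomial l (c * ((n + l).factorial / l.factorial)) := by
  rw [← Polynomial.C_mul_X_pow_eq_monomial, Polynomial.iterate_derivative_C_mul,
    Polynomial.iterate_derivative_X_pow_eq_C_mul, Nat.add_sub_cancel_left, ← mul_assoc, ← map_mul,
    Polynomial.C_mul_X_pow_eq_monomial]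
  congr 2
  have h : (l.factorial : ℂ) ≠ 0 := by exact_mod_cast l.factorial_ne_zero
  rw [eq_div_iff h, mul_comm]
  have := Nat.factorial_mul_descFactorial (Nat.le_add_right n l)
  rw [Nat.add_sub_cancel_left] at this
  exact_mod_cast this

theorem iterate_derivative_monomial_eq_zero {n k : ℕ} (h : k < n) (c : ℂ) :
    Polynomial.derivative^[n] (Polynomial.monomial k c) = 0 :=
  Polynomial.iterate_derivative_eq_zero ((Polynomial.natDegree_monomial_le c).trans_lt h)

theorem heunPoly_monomial (p m k : ℕ) :
    heunPoly p m (Polynomial.monomial k (√(k.factorial : ℝ) : ℂ)⁻¹) =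
      (heunWeight p m k : ℂ) • Polynomial.monomial (k + m) (√((k + m).factorial : ℝ) : ℂ)⁻¹ +
        if m ≤ k then (heunWeight p m (k - m) : ℂ) •
          Polynomial.monomial (k - m) (√((k - m).factorial : ℝ) : ℂ)⁻¹ else 0 := by
  by_cases hk : k < p
  · have h₁ : heunWeight p m k = 0 := if_pos hk
    have h₂ : heunWeight p m (k - m) = 0 := if_pos (by omega)
    rw [heunPoly, iterate_derivative_monomial_eq_zero hk, h₁, h₂]
    simp
  obtain ⟨n, rfl⟩ := Nat.exists_eq_add_of_le (not_lt.1 hk)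
  rw [heunPoly, iterate_derivative_monomial, heunWeight_add, mul_add, add_comm (_ * _), ← mul_assoc,
    ← pow_add, Polynomial.X_pow_mul_monomial, sqrt_factorial_inv_mul_factorial_div p m,
    Polynomial.smul_monomial, smul_eq_mul, show n + (p + m) = p + n + m by ring]
  congr 1
  by_cases hn : n < m
  · rw [iterate_derivative_monomial_eq_zero hn, mul_zero]
    split_ifs
    · rw [heunWeight, if_pos (by omega), Complex.ofReal_zero, zero_smul]
    · rfl
  · obtain ⟨l, rfl⟩ := Nat.exists_eq_add_of_le (not_lt.1 hn)
    rw [iterate_derivative_monomial, if_pos (by omega), show p + (m + l) - m = p + l by omega,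
      heunWeight_add, Polynomial.X_pow_mul_monomial, Polynomial.smul_monomial, smul_eq_mul,
      add_comm l p, ← sqrt_factorial_inv_mul_factorial_div' p m,
      ← sqrt_factorial_inv_mul_factorial_div p m, show p + (m + l) = p + l + m by ring]
    congr 1
    have h₁ : ((m + l).factorial : ℂ) ≠ 0 := by exact_mod_cast (m + l).factorial_ne_zero
    field_simp

namespace Bargmann

theorem coord_ofPolynomial_eq_zero {q : Polynomial ℂ} {k : ℕ} (h : q.natDegree < k) :
    coord (ofPolynomial q) k = 0 := by
  rw [coord, iteratedDeriv_eq_iterate]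
  have := congrFun (iterate_annihilation_eval k q) 0
  rw [Polynomial.iterate_derivative_eq_zero h, Polynomial.eval_zero] at this
  rw [show deriv^[k] (ofPolynomial q : ℂ → ℂ) 0 = 0 from this, mul_zero]

end Bargmann

theorem isSymmetricShift_heunCore (p m : ℕ) :
    IsSymmetricShift Bargmann.basis (heunWeight p m) m (heunCore p m) where
  domain_eq := by
    change polynomials = _
    refine le_antisymm ?_ (Submodule.span_le.2 ?_)
    · rintro _ ⟨q, rfl⟩
      exact Bargmann.basis.mem_span_of_repr_eq_zero (N := q.natDegree + 1) fun k hk =>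
        Bargmann.coord_ofPolynomial_eq_zero (by omega)
    · rintro _ ⟨k, rfl⟩
      exact ⟨_, Bargmann.basis_eq k⟩
  apply_basis k h := by
    ext z
    change heunExpr p m (Bargmann.basis k) z = _
    rw [Bargmann.basis_eq, ofPolynomial, Bargmann.coe_mk, heunExpr_eval, heunPoly_monomial,
      shiftVector]
    split_ifs <;> simp [-Complex.coe_smul, Bargmann.basis_eq, ofPolynomial]

/-! ### The basis of the functions that vanish to order `p` -/

namespace Bargmann

theorem mem_bargmannVanishing_iff {p : ℕ} {f : Bargmann} :
    f ∈ bargmannVanishing p ↔ ∀ k < p, ⟪basis k, f⟫_ℂ = 0 := by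
  refine forall₂_congr fun k _ => ?_
  rw [inner_basis, coord, mul_eq_zero, inv_eq_zero, or_iff_right (sqrt_factorial_ne_zero k)]

instance (p : ℕ) : CompleteSpace (bargmannVanishing p) := by
  refine IsClosed.completeSpace_coe (s := (bargmannVanishing p : Set Bargmann)) (hs := ?_)
  have : (bargmannVanishing p : Set Bargmann) = ⋂ k < p, {f | ⟪basis k, f⟫_ℂ = 0} := by
    ext f
    simp [mem_bargmannVanishing_iff]
  rw [this]
  exact isClosed_biInter fun k _ => isClosed_eq (by fun_prop) continuous_const

theorem basis_mem_bargmannVanishing (p k : ℕ) : basis (p + k) ∈ bargmannVanishing p :=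
  mem_bargmannVanishing_iff.2 fun j hj => by
    rw [orthonormal_iff_ite.1 basis.orthonormal, if_neg (by omega)]

theorem orthonormal_basis_add (p : ℕ) : Orthonormal ℂ fun k =>
    (⟨basis (p + k), basis_mem_bargmannVanishing p k⟩ : bargmannVanishing p) :=
  (basis.orthonormal.comp (fun k => p + k) (add_right_injective p)).codRestrict
    (bargmannVanishing p) fun k => basis_mem_bargmannVanishing p k

/-- The Hilbert basis `e (p + k)` of the subspace `bargmannVanishing p`. -/
def vanishingBasis (p : ℕ) : HilbertBasis ℕ ℂ (bargmannVanishing p) :=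
  HilbertBasis.mkOfOrthogonalEqBot (orthonormal_basis_add p) (by
      rw [Submodule.eq_bot_iff]
      intro f hf
      rw [Submodule.mem_orthogonal] at hf
      refine Subtype.ext (basis.repr.injective (lp.ext (funext fun k => ?_)))
      rw [ZeroMemClass.coe_zero, map_zero, basis.repr_apply_apply]
      by_cases hk : k < p
      · exact mem_bargmannVanishing_iff.1 f.2 k hk
      · obtain ⟨n, rfl⟩ := Nat.exists_eq_add_of_le (not_lt.1 hk)
        exact hf _ (Submodule.subset_span ⟨n, rfl⟩))

theorem coe_vanishingBasis (p k : ℕ) : (vanishingBasis p k : Bargmann) = basis (p + k) := by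
  rw [vanishingBasis, HilbertBasis.coe_mkOfOrthogonalEqBot]

theorem vanishingBasis_repr {p : ℕ} (f : bargmannVanishing p) (k : ℕ) :
    (vanishingBasis p).repr f k = coord (f : Bargmann) (p + k) := by
  rw [HilbertBasis.repr_apply_apply, Submodule.coe_inner, coe_vanishingBasis, inner_basis]

end Bargmann

theorem isSymmetricShift_heunCoreVanishing (p m : ℕ) :
    IsSymmetricShift (Bargmann.vanishingBasis p) (fun k => beta p m (p + k)) m
      (heunCoreVanishing p m) where
  domain_eq := by
    change polynomials.comap (bargmannVanishing p).subtype = _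
    refine le_antisymm ?_ (Submodule.span_le.2 ?_)
    · rintro f ⟨q, hq⟩
      refine (Bargmann.vanishingBasis p).mem_span_of_repr_eq_zero (N := q.natDegree + 1)
        fun k hk => ?_
      rw [Bargmann.vanishingBasis_repr, show (f : Bargmann) = ofPolynomial q from hq]
      exact Bargmann.coord_ofPolynomial_eq_zero (by omega)
    · rintro _ ⟨k, rfl⟩
      exact ⟨_, (Bargmann.coe_vanishingBasis p k).trans (Bargmann.basis_eq _)⟩
  apply_basis k h := by
    refine Subtype.ext ?_
    have hk : Bargmann.basis (p + k) ∈ (heunCore p m).domain := ⟨_, Bargmann.basis_eq _⟩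
    have h₁ := (isSymmetricShift_heunCore p m).apply_basis (p + k) hk
    have h₂ : (⟨(Bargmann.vanishingBasis p k : Bargmann), h⟩ : (heunCore p m).domain) =
        ⟨Bargmann.basis (p + k), hk⟩ := Subtype.ext (Bargmann.coe_vanishingBasis p k)
    change heunCore p m ⟨(Bargmann.vanishingBasis p k : Bargmann), h⟩ = _
    rw [h₂, h₁, shiftVector, shiftVector, Submodule.coe_add, Submodule.coe_smul,
      Bargmann.coe_vanishingBasis, heunWeight_add, add_assoc]
    congr 1
    by_cases hmk : m ≤ k
    · rw [if_pos hmk, if_pos (by omega), Submodule.coe_smul, Bargmann.coe_vanishingBasis,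
        Nat.add_sub_assoc hmk, heunWeight_add]
    · rw [if_neg hmk, ZeroMemClass.coe_zero]
      split_ifs
      · rw [heunWeight, if_pos (by omega), Complex.ofReal_zero, zero_smul]
      · rfl

/-! ### The block Jacobi matrix as a symmetric weighted shift -/

section Block

variable {m : ℕ} [NeZero m]

/-- The unit vectors of the block sequences, numbered consecutively. -/
def blockVector (m : ℕ) [NeZero m] (k : ℕ) : BlockSeq m :=
  lp.single 2 (k / m) (EuclideanSpace.single (Fin.ofNat m k) 1)

theorem inner_blockVector (k : ℕ) (φ : BlockSeq m) :
    ⟪blockVector m k, φ⟫_ℂ = φ (k / m) (Fin.ofNat m k) := by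
  rw [blockVector, lp.inner_single_left, EuclideanSpace.inner_single_left]
  simp

theorem div_mul_add (i : ℕ) (j : Fin m) : (i * m + j) / m = i := by
  rw [mul_comm, Nat.mul_add_div (Nat.pos_of_neZero m), Nat.div_eq_of_lt j.2, add_zero]

theorem ofNat_mul_add (i : ℕ) (j : Fin m) : Fin.ofNat m (i * m + j) = j := by
  ext
  simp [Fin.ofNat, Nat.mod_eq_of_lt j.2]

theorem exists_eq_mul_add (m : ℕ) [NeZero m] (k : ℕ) : ∃ (i : ℕ) (j : Fin m), k = i * m + j :=
  ⟨k / m, Fin.ofNat m k, (Nat.div_add_mod' k m).symm⟩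

theorem blockVector_mul_add (i : ℕ) (j : Fin m) :
    blockVector m (i * m + j) = lp.single 2 i (EuclideanSpace.single j 1) := by
  rw [blockVector, div_mul_add, ofNat_mul_add]

theorem orthonormal_blockVector : Orthonormal ℂ (blockVector m) := by
  rw [orthonormal_iff_ite]
  intro k l
  obtain ⟨i, j, rfl⟩ := exists_eq_mul_add m k
  obtain ⟨i', j', rfl⟩ := exists_eq_mul_add m l
  rw [inner_blockVector, div_mul_add, ofNat_mul_add, blockVector_mul_add, lp.single_apply]
  by_cases hi : i = i'
  · subst hi
    simp [Fin.ext_iff]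
  · have : i * m + j ≠ i' * m + j' := fun h => hi (by
      rw [← div_mul_add i j, h, div_mul_add])
    simp [hi, this]

/-- The Hilbert basis of unit vectors of the block sequences. -/
def blockBasis (m : ℕ) [NeZero m] : HilbertBasis ℕ ℂ (BlockSeq m) :=
  HilbertBasis.mkOfOrthogonalEqBot (orthonormal_blockVector (m := m)) (by
    rw [Submodule.eq_bot_iff]
    intro φ hφ
    rw [Submodule.mem_orthogonal] at hφ
    refine lp.ext (funext fun i => ?_)
    ext j
    have h := hφ _ (Submodule.subset_span ⟨i * m + j, rfl⟩)
    rwa [inner_blockVector, div_mul_add, ofNat_mul_add] at h)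

theorem coe_blockBasis : ⇑(blockBasis m) = blockVector m := by
  rw [blockBasis, HilbertBasis.coe_mkOfOrthogonalEqBot]

theorem blockBasis_repr (φ : BlockSeq m) (i : ℕ) (j : Fin m) :
    (blockBasis m).repr φ (i * m + j) = φ i j := by
  rw [HilbertBasis.repr_apply_apply, coe_blockBasis, inner_blockVector, div_mul_add, ofNat_mul_add]

theorem toEuclideanLin_heunBlock (p i : ℕ) (v : EuclideanSpace ℂ (Fin m)) (j : Fin m) :
    Matrix.toEuclideanLin (heunBlock p m i) v j = beta p m (p + (i * m + j)) * v j := by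
  rw [Matrix.toLpLin_apply, heunBlock, ← add_assoc p]
  exact Matrix.mulVec_diagonal (fun j : Fin m => (beta p m (p + i * m + j) : ℂ)) v.ofLp j

theorem toEuclideanLin_heunBlock_conjTranspose (p i : ℕ) (v : EuclideanSpace ℂ (Fin m))
    (j : Fin m) : Matrix.toEuclideanLin (heunBlock p m i).conjTranspose v j =
      beta p m (p + (i * m + j)) * v j := by
  have h : (heunBlock p m i).conjTranspose = heunBlock p m i := by
    rw [heunBlock, Matrix.diagonal_conjTranspose]
    congr 1
    funext j
    exact Complex.conj_ofReal _
  rw [h, toEuclideanLin_heunBlock]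

/-- With diagonal blocks each component interacts only with itself in the neighbouring blocks, at
consecutive indices `l ± m`; the blocks are real, so the adjoint changes nothing. -/
theorem repr_jacobiCore (p : ℕ) (φ : (jacobiCore (fun _ => 0) (heunBlock p m)).domain) (l : ℕ) :
    (blockBasis m).repr (jacobiCore (fun _ => 0) (heunBlock p m) φ) l =
      beta p m (p + l) * (blockBasis m).repr φ.1 (l + m) +
        if m ≤ l then beta p m (p + (l - m)) * (blockBasis m).repr φ.1 (l - m) else 0 := by
  obtain ⟨i, j, rfl⟩ := exists_eq_mul_add m l
  rw [show i * m + j + m = (i + 1) * m + j by ring, blockBasis_repr, blockBasis_repr]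
  change jacobiAction (fun _ => 0) (heunBlock p m) φ.1 i j = _
  cases i with
  | zero =>
    rw [if_neg (by have := j.2; omega), jacobiAction, map_zero, LinearMap.zero_apply, zero_add,
      add_zero]
    exact toEuclideanLin_heunBlock p 0 _ j
  | succ i =>
    rw [if_pos (by rw [add_one_mul]; omega),
      show (i + 1) * m + j - m = i * m + j by rw [add_one_mul]; omega, blockBasis_repr,
      jacobiAction, map_zero, LinearMap.zero_apply, add_zero, add_comm, PiLp.add_apply,
      toEuclideanLin_heunBlock, toEuclideanLin_heunBlock_conjTranspose]

theorem isSymmetricShift_jacobiCore (p : ℕ) :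
    IsSymmetricShift (blockBasis m) (fun k => beta p m (p + k)) m
      (jacobiCore (fun _ => 0) (heunBlock p m)) where
  domain_eq := by
    change finiteSeq m = _
    refine le_antisymm ?_ (Submodule.span_le.2 ?_)
    · rintro φ ⟨N, hN⟩
      refine (blockBasis m).mem_span_of_repr_eq_zero (N := N * m) fun k hk => ?_
      rw [HilbertBasis.repr_apply_apply, coe_blockBasis, inner_blockVector,
        hN _ ((Nat.le_div_iff_mul_le (Nat.pos_of_neZero m)).2 hk)]
      rfl
    · rintro _ ⟨k, rfl⟩
      refine ⟨k / m + 1, fun i hi => ?_⟩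
      rw [coe_blockBasis, blockVector, lp.single_apply_ne _ _ _ (by omega)]
  apply_basis k h := by
    refine (blockBasis m).repr.injective (lp.ext (funext fun l => ?_))
    have ho := orthonormal_iff_ite.1 (blockBasis m).orthonormal
    rw [repr_jacobiCore, HilbertBasis.repr_apply_apply, HilbertBasis.repr_apply_apply,
      HilbertBasis.repr_apply_apply, IsSymmetricShift.inner_basis_shiftVector, ho, ho, add_comm]
    congr 1
    · by_cases hl : m ≤ l
      · rw [if_pos hl]
        by_cases hk : l - m = k
        · rw [if_pos hk, if_pos (by omega), hk, mul_one]
        · rw [if_neg hk, if_neg (by omega), mul_zero]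
      · rw [if_neg hl, if_neg (by omega)]
    · by_cases hk : k = l + m
      · rw [if_pos hk, if_pos hk.symm, mul_one]
      · rw [if_neg hk, if_neg (Ne.symm hk), mul_zero]

end Block

end Heun

end

theorem theorem3p5 (p m : ℕ) (hp : 1 ≤ p) (hm : 1 ≤ m) (hpm : 1 < (p : ℝ) + (m : ℝ) / 2) :
    (∃ U : Heun.BlockSeq m ≃ₗᵢ[ℂ] Heun.bargmannVanishing p,
      (∀ (i : ℕ) (j : Fin m),
        ((U (lp.single 2 i (EuclideanSpace.single j 1)) : Heun.Bargmann) : ℂ → ℂ)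
          = Heun.e (p + i * m + j)) ∧
      ∀ φ ψ : Heun.BlockSeq m,
        (φ, ψ) ∈ (Heun.jacobiMinimal (fun _ => 0) (Heun.heunBlock p m)).graph ↔
          (U φ, U ψ) ∈ (Heun.heunMinimalVanishing p m).graph) ∧
    Heun.IsCompletelyIndeterminate (Heun.heunMinimalVanishing p m) m ∧
    Heun.IsCompletelyIndeterminate (Heun.heunMinimal p m) m := by
  have hm0 : m ≠ 0 := by omega
  have : NeZero m := ⟨hm0⟩
  have hs := Heun.summable_inv_beta hpm
  refine ⟨⟨(Heun.blockBasis m).repr.trans (Heun.Bargmann.vanishingBasis p).repr.symm,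
    fun i j => ?_, ?_⟩, ?_, ?_⟩
  · rw [← Heun.blockVector_mul_add, ← Heun.coe_blockBasis, LinearIsometryEquiv.trans_apply,
      HilbertBasis.repr_self, HilbertBasis.repr_symm_single, Heun.Bargmann.coe_vanishingBasis,
      Heun.Bargmann.coe_basis, add_assoc]
  · exact (Heun.isSymmetricShift_jacobiCore p).mem_graph_closure_iff
      (Heun.isSymmetricShift_heunCoreVanishing p m)
  · refine (Heun.isSymmetricShift_heunCoreVanishing p m).isCompletelyIndeterminate_closure
      (q := 0) hm0 (by simp) (fun k _ => Heun.beta_pos p m _) (fun k _ => ?_) hs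
    simpa only [add_assoc] using Heun.beta_log_concave p m k
  -- In the whole space the weights vanish below `q = p`; in the subspace above, indexing starts at
  -- `e p` and `q = 0`.
  · refine (Heun.isSymmetricShift_heunCore p m).isCompletelyIndeterminate_closure
      (q := p) hm0 (fun k hk => if_pos hk) (fun k hk => ?_) (fun k hk => ?_) ?_
    · rw [Heun.heunWeight, if_neg (by omega)]
      exact Heun.beta_pos p m k
    · obtain ⟨n, rfl⟩ := Nat.exists_eq_add_of_le hk
      have := Heun.beta_log_concave p m n
      simp only [add_assoc] at this ⊢
      simpa only [Heun.heunWeight_add] using this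
    · refine (summable_nat_add_iff p).1 ?_
      simpa only [add_comm _ p, Heun.heunWeight_add] using hs
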